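/- Fix $L>0$ and let $\mathbb{T}^2=(\mathbb{R}/L\mathbb{Z})^2$ be the flat torus, each tangent space $T_z\mathbb{T}^2$ being identified with $\mathbb{R}^2$ with the Euclidean norm. Let $a_0<b_0<a_1<b_1<a_0+L$ and $c_0<d_0<c_1<d_1<c_0+L$ be real numbers and let $k_0,k_1,l_0,l_1\ge 1$ be integers. Let $P_i=\{(x,y):y\in[a_i,b_i]\bmod L\}$ and $Q_i=\{(x,y):x\in[c_i,d_i]\bmod L\}$ ($i=0,1$), with boundaries $\partial P_i=\{(x,y): y\in\{a_i,b_i\}\}$ and $\partial Q_i=\{(x,y):x\in\{c_i,d_i\}\}$ (mod $L$). Put $P=P_0\cup P_1$, $Q=Q_0\cup Q_1$, $\partial P=\partial P_0\cup\partial P_1$, $\partial Q=\partial Q_0\cup\partial Q_1$ and $R=P\cup Q$. Let $f:\mathbb{R}/L\mathbb{Z}\to\mathbb{R}/L\mathbb{Z}$ be the piecewise linear twist function with $f(y)=k_iL\,\frac{y-a_i}{b_i-a_i}\bmod L$ for $y\in[a_i,b_i]$ and $f=0$ elsewhere, and let $g$ be defined likewise by $g(x)=l_iL\,\frac{x-c_i}{d_i-c_i}\bmod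 L$ for $x\in[c_i,d_i]$ and $g=0$ elsewhere. Let $F(x,y)=(x+f(y),y)$, $G(x,y)=(x,y+g(x))$ and let $H=G\circ F$ be the linked-twist map. Let $\mu$ be the normalized Lebesgue measure on $R$, $\mu(A)=\mathrm{Leb}(A\cap R)/\mathrm{Leb}(R)$. Let $s_0=\partial P\cup F^{-1}(\partial Q)$, $V=R\setminus s_0$, $N=V\setminus H^{-1}(s_0)$ and $J=\bigcap_{i\in\mathbb{Z}}H^i(N)$. Then the Lyapunov exponents of $H|_N$ exist for $\mu$-a.e. $z\in R$ and every non-zero tangent vector. That is, for $\mu$-a.e. $z\in R$ one has $z\in J$, every iterate $H^n$ ($n\in\mathbb{Z}$) is differentiable at $z$, and for every non-zero $v\in T_z\mathbb{T}^2$ both limits $$\chi^{+}(z,v)=\lim_{n\to+\infty}\frac1n\log\|DH^n_z v\|,\qquad \chi^{-}(z,v)=\lim_{n\to-\infty}\frac1n\log\|DH^n_z v\|$$ exist and are finite. -/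

import Mathlib

noncomputable section

/-- The flat two-torus of side length `L`. -/
abbrev Torus (L : ℝ) : Type := AddCircle L × AddCircle L

/-- The tangent space `T_z 𝕋²`, identified with the Euclidean plane. -/
abbrev Tangent : Type := EuclideanSpace ℝ (Fin 2)

/-- Two disjoint closed arcs `[lo i, hi i]` (mod `L`) of the circle `ℝ / L ℤ`, each with
the number of times `wrap i ≥ 1` that the twist supported on it wraps around the circle. -/
structure TwistData (L : ℝ) where
  lo : Fin 2 → ℝ
  hi : Fin 2 → ℝ
  wrap : Fin 2 → ℕ
  lo_zero_lt_hi_zero : lo 0 < hi 0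
  hi_zero_lt_lo_one : hi 0 < lo 1
  lo_one_lt_hi_one : lo 1 < hi 1
  hi_one_lt : hi 1 < lo 0 + L
  wrap_pos : ∀ i, 0 < wrap i

namespace TwistData

variable {L : ℝ} (T : TwistData L)

/-- The `i`-th arc on the circle. -/
def arc (i : Fin 2) : Set (AddCircle L) :=
  (fun t : ℝ => (t : AddCircle L)) '' Set.Icc (T.lo i) (T.hi i)

/-- The union of the two arcs. -/
def arcs : Set (AddCircle L) := ⋃ i, T.arc i

/-- The four endpoints of the two arcs. -/
def endpoints : Set (AddCircle L) :=
  {y | ∃ i, y = (T.lo i : AddCircle L) ∨ y = (T.hi i : AddCircle L)}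

variable [Fact (0 < L)]

/-- The piecewise linear twist supported on the `i`-th arc. With `t` the representative in
`[lo i, lo i + L)`, it is linear from `0` to `wrap i * L ≡ 0` on the arc, and `0` off it. -/
def twistOn (i : Fin 2) (y : AddCircle L) : AddCircle L :=
  let t : ℝ := (AddCircle.equivIco L (T.lo i) y : ℝ)
  if t ≤ T.hi i then
    (((T.wrap i : ℝ) * L * ((t - T.lo i) / (T.hi i - T.lo i)) : ℝ) : AddCircle L)
  else 0

/-- The twist function of the circle; it vanishes off the two arcs. -/
def twist (y : AddCircle L) : AddCircle L := ∑ i, T.twistOn i y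

end TwistData

/-- A toral linked-twist map on four annuli: `p` describes the horizontal annuli `P₀, P₁`
(and the twist function `f` of `y`), `q` the vertical annuli `Q₀, Q₁` (and `g` of `x`). -/
structure LinkedTwist (L : ℝ) where
  p : TwistData L
  q : TwistData L

namespace LinkedTwist

variable {L : ℝ} (Λ : LinkedTwist L)

/-- `P = P₀ ∪ P₁`. -/
def P : Set (Torus L) := {z | z.2 ∈ Λ.p.arcs}

/-- `Q = Q₀ ∪ Q₁`. -/
def Q : Set (Torus L) := {z | z.1 ∈ Λ.q.arcs}

/-- The union of the four annuli. -/
def R : Set (Torus L) := Λ.P ∪ Λ.Q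

/-- `∂P = ∂P₀ ∪ ∂P₁`. -/
def bdP : Set (Torus L) := {z | z.2 ∈ Λ.p.endpoints}

/-- `∂Q = ∂Q₀ ∪ ∂Q₁`. -/
def bdQ : Set (Torus L) := {z | z.1 ∈ Λ.q.endpoints}

variable [Fact (0 < L)]

/-- The horizontal twist `F (x, y) = (x + f y, y)`. -/
def F : Equiv.Perm (Torus L) where
  toFun z := (z.1 + Λ.p.twist z.2, z.2)
  invFun z := (z.1 - Λ.p.twist z.2, z.2)
  left_inv z := by simp
  right_inv z := by simp

/-- The vertical twist `G (x, y) = (x, y + g x)`. -/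
def G : Equiv.Perm (Torus L) where
  toFun z := (z.1, z.2 + Λ.q.twist z.1)
  invFun z := (z.1, z.2 - Λ.q.twist z.1)
  left_inv z := by simp
  right_inv z := by simp

/-- The linked-twist map `H = G ∘ F`. -/
def H : Equiv.Perm (Torus L) := Λ.G * Λ.F

/-- The set `s₀ = ∂P ∪ F⁻¹(∂Q)` off which `H` is differentiable. -/
def s₀ : Set (Torus L) := Λ.bdP ∪ Λ.F ⁻¹' Λ.bdQ

/-- `V = R \ s₀`. -/
def V : Set (Torus L) := Λ.R \ Λ.s₀

/-- `N = V \ H⁻¹(s₀)`. -/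
def N : Set (Torus L) := Λ.V \ Λ.H ⁻¹' Λ.s₀

/-- The intersection of all images and pre-images of `N`, that is, the set of points at which
every iterate, forward and backward, of the restriction `H|_N` is defined and lies in `N`. -/
def J : Set (Torus L) := ⋂ i : ℤ, (Λ.H ^ i : Equiv.Perm (Torus L)) '' Λ.N

/-- Normalized Lebesgue measure on `R`: `μ(A) = Leb(A ∩ R) / Leb(R)`. -/
def μ : MeasureTheory.Measure (Torus L) :=
  ProbabilityTheory.cond MeasureTheory.volume Λ.R

end LinkedTwist

/-- The exponential map of the flat torus at `z`. -/
def torusExp {L : ℝ} (z : Torus L) (h : Tangent) : Torus L :=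
  (z.1 + (h 0 : AddCircle L), z.2 + (h 1 : AddCircle L))

variable {L : ℝ} [Fact (0 < L)]

/-- The representative in `[-L/2, L/2)²` of a point of the torus. Near `0` it is the inverse
of the exponential map at `0`. -/
def torusLog (w : Torus L) : Tangent :=
  !₂[(AddCircle.equivIco L (-(L / 2)) w.1 : ℝ), (AddCircle.equivIco L (-(L / 2)) w.2 : ℝ)]

/-- The expression of `φ : 𝕋² → 𝕋²` in the exponential charts centred at `z` and `φ z`. -/
def torusLocal (φ : Torus L → Torus L) (z : Torus L) (h : Tangent) : Tangent :=
  torusLog (φ (torusExp z h) - φ z)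

/-- Differentiability of a self-map of the torus at a point. -/
def TorusDifferentiableAt (φ : Torus L → Torus L) (z : Torus L) : Prop :=
  DifferentiableAt ℝ (torusLocal φ z) 0

/-- The derivative `Dφ_z : T_z 𝕋² → T_{φ z} 𝕋²` (zero if `φ` is not differentiable at `z`). -/
def torusDeriv (φ : Torus L → Torus L) (z : Torus L) : Tangent →L[ℝ] Tangent :=
  fderiv ℝ (torusLocal φ z) 0

/-- The number `χ` is the limit of `(1/n) log ‖Dφⁿ_z v‖` as `n` tends along the filter `l` on
`ℤ`. The forward exponent is the case `n → +∞`, the backward exponent `n → -∞`. -/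
def IsLyapunovExponent (φ : Equiv.Perm (Torus L)) (l : Filter ℤ) (z : Torus L) (v : Tangent)
    (χ : ℝ) : Prop :=
  Filter.Tendsto
    (fun n : ℤ => (1 / (n : ℝ)) * Real.log ‖torusDeriv (φ ^ n : Equiv.Perm (Torus L)) z v‖)
    l (nhds χ)

end

/-!
Both twists are shears of nonnegative slope, so off a null set `DH` is a nonnegative unimodular
matrix whose diagonal entries are at least one. Pushing the horizontal axis forward from the past
gives a monotone sequence of directions in the closed first quadrant; its limit is an invariant
direction field along which `DH` expands. Conjugated by a reflection, `DH⁻¹` is a matrix of the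
same kind, which gives an invariant field in the closed second quadrant along which `DH` contracts.
Birkhoff's theorem provides the growth rates along the two fields. Where the fields are transverse,
preservation of area bounds from below the growth of every vector off the contracted field, which
therefore has the rate of the expanded one. Where they coincide they lie on a coordinate axis; all
derivatives along the orbit are then shears parallel to that axis, and every rate is zero.
-/

open MeasureTheory Filter Topology

section PointwiseErgodicTheorem

variable {X : Type*} {T : X → X} {f : X → ℝ}

/-- The maximum of the Birkhoff sums of `f` of length at most `n`, the empty sum included. It
is defined by the recursion that drives the proof of the maximal ergodic theorem. -/
noncomputable def birkhoffMax (T : X → X) (f : X → ℝ) : ℕ → X → ℝ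
  | 0, _ => 0
  | n + 1, x => max 0 (f x + birkhoffMax T f n (T x))

lemma birkhoffMax_nonneg (n : ℕ) (x : X) : 0 ≤ birkhoffMax T f n x := by
  cases n
  exacts [le_rfl, le_max_left _ _]

lemma birkhoffMax_le_succ (n : ℕ) (x : X) : birkhoffMax T f n x ≤ birkhoffMax T f (n + 1) x := by
  induction n generalizing x with
  | zero => exact birkhoffMax_nonneg 1 x
  | succ n ih => exact max_le_max le_rfl (add_le_add_right (ih (T x)) (f x))

lemma birkhoffSum_le_birkhoffMax (n : ℕ) (x : X) : birkhoffSum T f n x ≤ birkhoffMax T f n x := by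
  induction n generalizing x with
  | zero => exact (birkhoffSum_zero T f x).le
  | succ n ih =>
    rw [birkhoffSum_succ']
    exact le_max_of_le_right (add_le_add_right (ih (T x)) (f x))

lemma birkhoffMax_sub_comp_le_indicator (n : ℕ) (x : X) :
    birkhoffMax T f (n + 1) x - birkhoffMax T f (n + 1) (T x) ≤
      {y | 0 < birkhoffMax T f (n + 1) y}.indicator f x := by
  by_cases hx : 0 < birkhoffMax T f (n + 1) x
  · have hmax : birkhoffMax T f (n + 1) x = f x + birkhoffMax T f n (T x) :=
      max_eq_right ((lt_max_iff.1 hx).resolve_left (lt_irrefl 0)).le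
    rw [Set.indicator_of_mem (by exact hx)]
    linarith [birkhoffMax_le_succ (T := T) (f := f) n (T x)]
  · rw [Set.indicator_of_notMem (by exact hx)]
    linarith [birkhoffMax_nonneg (T := T) (f := f) (n + 1) (T x)]

/-- The points at which the excesses `∑ k < n, (f (T^[k] x) - b)` of the Birkhoff sums over the
slope `b` are unbounded above. Membership is invariant under `T` and implied by averages that
are frequently at least `b' > b`. -/
def birkhoffExceeds (T : X → X) (f : X → ℝ) (b : ℝ) : Set X :=
  {x | ¬ BddAbove (Set.range fun n => birkhoffSum T (fun y => f y - b) n x)}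

lemma preimage_birkhoffExceeds (b : ℝ) : T ⁻¹' birkhoffExceeds T f b = birkhoffExceeds T f b := by
  ext x
  refine not_congr ⟨fun ⟨C, hC⟩ => ⟨max 0 (f x - b + C), ?_⟩, fun ⟨C, hC⟩ => ⟨C - (f x - b), ?_⟩⟩
  · rintro _ ⟨n, rfl⟩
    cases n with
    | zero => exact le_max_left _ _
    | succ n =>
      beta_reduce
      rw [birkhoffSum_succ']
      exact le_max_of_le_right (add_le_add_right (hC ⟨n, rfl⟩) _)
  · rintro _ ⟨n, rfl⟩
    have hsum : birkhoffSum T (fun y => f y - b) (n + 1) x ≤ C := hC ⟨n + 1, rfl⟩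
    rw [birkhoffSum_succ'] at hsum
    exact le_sub_iff_add_le'.2 hsum

lemma natCast_mul_birkhoffAverage (n : ℕ) (x : X) :
    n * birkhoffAverage ℝ T f n x = birkhoffSum T f n x := by
  rcases eq_or_ne n 0 with rfl | hn
  · simp
  · exact mul_inv_cancel_left₀ (Nat.cast_ne_zero.2 hn) _

lemma birkhoffSum_sub_const (b : ℝ) (n : ℕ) (x : X) :
    birkhoffSum T (fun y => f y - b) n x = n * (birkhoffAverage ℝ T f n x - b) := by
  rw [mul_sub, natCast_mul_birkhoffAverage]
  simp [birkhoffSum]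

lemma birkhoffSum_isBigO_natCast {l : ℝ} {x : X}
    (h : Tendsto (fun n => birkhoffAverage ℝ T f n x) atTop (𝓝 l)) :
    (fun n => birkhoffSum T f n x) =O[atTop] fun n : ℕ => (n : ℝ) := by
  simpa [natCast_mul_birkhoffAverage] using
    (Asymptotics.isBigO_refl (fun n : ℕ => (n : ℝ)) atTop).mul (h.isBigO_one ℝ)

lemma mem_birkhoffExceeds_of_frequently {b b' : ℝ} (hb : b < b') {x : X}
    (h : ∃ᶠ n in atTop, b' ≤ birkhoffAverage ℝ T f n x) : x ∈ birkhoffExceeds T f b := by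
  rintro ⟨C, hC⟩
  have hlarge : ∀ᶠ n : ℕ in atTop, C < n * (b' - b) :=
    (tendsto_natCast_atTop_atTop.atTop_mul_const (sub_pos.2 hb)).eventually_gt_atTop C
  obtain ⟨n, hn, hCn⟩ := (h.and_eventually hlarge).exists
  have hsum := hC ⟨n, birkhoffSum_sub_const b n x⟩
  have : (n : ℝ) * (b' - b) ≤ n * (birkhoffAverage ℝ T f n x - b) := by gcongr
  linarith

lemma isBoundedUnder_birkhoffAverage {b : ℝ} {x : X} (hx : x ∉ birkhoffExceeds T f b) :
    IsBoundedUnder (· ≤ ·) atTop fun n => birkhoffAverage ℝ T f n x := by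
  refine isBoundedUnder_of_eventually_le (a := b + 1) ?_
  have := not_frequently.1 (mt (mem_birkhoffExceeds_of_frequently (lt_add_one b)) hx)
  filter_upwards [this] with n hn using (not_le.1 hn).le

variable [MeasurableSpace X]

lemma measurable_birkhoffMax (hT : Measurable T) (hf : Measurable f) (n : ℕ) :
    Measurable (birkhoffMax T f n) := by
  induction n with
  | zero => exact measurable_const
  | succ n ih => exact measurable_const.max (hf.add (ih.comp hT))

lemma measurable_birkhoffSum (hT : Measurable T) (hf : Measurable f) (n : ℕ) :
    Measurable (birkhoffSum T f n) :=
  Finset.measurable_fun_sum _ fun k _ => hf.comp (hT.iterate k)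

lemma measurableSet_birkhoffExceeds (hT : Measurable T) (hf : Measurable f) (b : ℝ) :
    MeasurableSet (birkhoffExceeds T f b) :=
  (measurableSet_bddAbove_range fun n => measurable_birkhoffSum hT (hf.sub_const b) n).compl

variable {μ : Measure X}

lemma integrable_birkhoffMax (hT : MeasurePreserving T μ μ) (hf : Integrable f μ) (n : ℕ) :
    Integrable (birkhoffMax T f n) μ := by
  induction n with
  | zero => exact integrable_zero X ℝ μ
  | succ n ih =>
    exact (integrable_zero X ℝ μ).sup (hf.add (hT.integrable_comp_of_integrable ih))

lemma setIntegral_birkhoffMax_pos_nonneg (hT : MeasurePreserving T μ μ) (hf : Measurable f)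
    (hfi : Integrable f μ) (n : ℕ) : 0 ≤ ∫ x in {x | 0 < birkhoffMax T f (n + 1) x}, f x ∂μ := by
  have hMm := measurable_birkhoffMax hT.measurable hf (n + 1)
  have hM := integrable_birkhoffMax hT hfi (n + 1)
  have hMT : Integrable (fun x => birkhoffMax T f (n + 1) (T x)) μ :=
    hT.integrable_comp_of_integrable hM
  have hE : MeasurableSet {x | 0 < birkhoffMax T f (n + 1) x} :=
    measurableSet_lt measurable_const hMm
  have hinv : ∫ x, birkhoffMax T f (n + 1) (T x) ∂μ = ∫ x, birkhoffMax T f (n + 1) x ∂μ := by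
    conv_rhs => rw [← hT.map_eq]
    exact (integral_map hT.measurable.aemeasurable hMm.aestronglyMeasurable).symm
  calc 0 = ∫ x, (birkhoffMax T f (n + 1) x - birkhoffMax T f (n + 1) (T x)) ∂μ := by
        rw [integral_sub hM hMT, hinv, sub_self]
    _ ≤ ∫ x, {x | 0 < birkhoffMax T f (n + 1) x}.indicator f x ∂μ :=
        integral_mono (hM.sub hMT) (hfi.indicator hE) (birkhoffMax_sub_comp_le_indicator n)
    _ = _ := integral_indicator hE

/-- A form of the maximal ergodic theorem. -/
theorem integral_nonneg_of_exists_birkhoffSum_pos (hT : MeasurePreserving T μ μ)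
    (hf : Measurable f) (hfi : Integrable f μ) (hpos : ∀ᵐ x ∂μ, ∃ n, 0 < birkhoffSum T f n x) :
    0 ≤ ∫ x, f x ∂μ := by
  let E : ℕ → Set X := fun n => {x | 0 < birkhoffMax T f n x}
  have hE (n : ℕ) : MeasurableSet (E n) :=
    measurableSet_lt measurable_const (measurable_birkhoffMax hT.measurable hf n)
  have hmono : Monotone E :=
    monotone_nat_of_le_succ fun n x hx => lt_of_lt_of_le hx (birkhoffMax_le_succ n x)
  have hcover : ∀ᵐ x ∂μ, x ∉ ⋃ n, E n → f x = 0 := by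
    filter_upwards [hpos] with x ⟨n, hn⟩ hx
    exact absurd (Set.mem_iUnion.2 ⟨n, hn.trans_le (birkhoffSum_le_birkhoffMax n x)⟩) hx
  have hlim := tendsto_setIntegral_of_monotone (f := f) hE hmono hfi.integrableOn
  rw [setIntegral_eq_integral_of_ae_compl_eq_zero hcover] at hlim
  exact ge_of_tendsto' ((tendsto_add_atTop_iff_nat 1).2 hlim)
    (setIntegral_birkhoffMax_pos_nonneg hT hf hfi)

variable [IsFiniteMeasure μ]

lemma mul_measureReal_le_setIntegral (hT : MeasurePreserving T μ μ) (hf : Measurable f)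
    (hfi : Integrable f μ) {b : ℝ} {E : Set X} (hE : MeasurableSet E) (hinv : T ⁻¹' E = E)
    (hsub : E ⊆ birkhoffExceeds T f b) : b * μ.real E ≤ ∫ x in E, f x ∂μ := by
  have hTE : MeasurePreserving T (μ.restrict E) (μ.restrict E) := by
    simpa only [hinv] using hT.restrict_preimage hE
  have hpos : ∀ᵐ x ∂μ.restrict E, ∃ n, 0 < birkhoffSum T (fun y => f y - b) n x := by
    filter_upwards [ae_restrict_mem hE] with x hx
    by_contra! h
    exact hsub hx ⟨0, Set.forall_mem_range.2 h⟩
  have := integral_nonneg_of_exists_birkhoffSum_pos hTE (hf.sub_const b)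
    (hfi.integrableOn.sub (integrable_const b)) hpos
  rw [integral_sub hfi.integrableOn (integrable_const b), setIntegral_const, smul_eq_mul] at this
  linarith

lemma measure_birkhoffExceeds_inter_eq_zero (hT : MeasurePreserving T μ μ) (hf : Measurable f)
    (hfi : Integrable f μ) {a b : ℝ} (hab : a < b) :
    μ (birkhoffExceeds T f b ∩ birkhoffExceeds T (-f) (-a)) = 0 := by
  set E := birkhoffExceeds T f b ∩ birkhoffExceeds T (-f) (-a)
  have hE : MeasurableSet E := (measurableSet_birkhoffExceeds hT.measurable hf b).inter
    (measurableSet_birkhoffExceeds hT.measurable hf.neg (-a))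
  have hinv : T ⁻¹' E = E := by
    rw [Set.preimage_inter, preimage_birkhoffExceeds, preimage_birkhoffExceeds]
  have hlower : b * μ.real E ≤ ∫ x in E, f x ∂μ :=
    mul_measureReal_le_setIntegral hT hf hfi hE hinv Set.inter_subset_left
  have hupper : -a * μ.real E ≤ ∫ x in E, -f x ∂μ :=
    mul_measureReal_le_setIntegral hT hf.neg hfi.neg hE hinv Set.inter_subset_right
  rw [integral_neg] at hupper
  rw [← measureReal_eq_zero_iff]
  nlinarith [measureReal_nonneg (μ := μ) (s := E)]

lemma ae_isBoundedUnder_birkhoffAverage (hT : MeasurePreserving T μ μ) (hf : Measurable f)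
    (hfi : Integrable f μ) :
    ∀ᵐ x ∂μ, IsBoundedUnder (· ≤ ·) atTop fun n => birkhoffAverage ℝ T f n x := by
  let E := ⋂ k : ℕ, birkhoffExceeds T f k
  have hE : MeasurableSet E :=
    .iInter fun k => measurableSet_birkhoffExceeds hT.measurable hf k
  have hinv : T ⁻¹' E = E := by
    simp only [E, Set.preimage_iInter, preimage_birkhoffExceeds]
  have hbound (k : ℕ) : k * μ.real E ≤ ∫ x in E, f x ∂μ :=
    mul_measureReal_le_setIntegral hT hf hfi hE hinv (Set.iInter_subset _ k)
  have hnull : μ E = 0 := by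
    rw [← measureReal_eq_zero_iff]
    by_contra hne
    obtain ⟨k, hk⟩ := exists_nat_gt ((∫ x in E, f x ∂μ) / μ.real E)
    have hpos : 0 < μ.real E := measureReal_nonneg.lt_of_ne' hne
    exact (hbound k).not_gt ((div_lt_iff₀ hpos).1 hk)
  filter_upwards [measure_eq_zero_iff_ae_notMem.1 hnull] with x hx
  obtain ⟨k, hk⟩ := not_forall.1 (mt Set.mem_iInter.2 hx)
  exact isBoundedUnder_birkhoffAverage hk

lemma ae_exists_tendsto_birkhoffAverage_of_measurable (hT : MeasurePreserving T μ μ)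
    (hf : Measurable f) (hfi : Integrable f μ) :
    ∀ᵐ x ∂μ, ∃ l : ℝ, Tendsto (fun n => birkhoffAverage ℝ T f n x) atTop (𝓝 l) := by
  have hosc : ∀ᵐ x ∂μ, ∀ a b : ℚ, (a : ℝ) < b →
      x ∉ birkhoffExceeds T f b ∩ birkhoffExceeds T (-f) (-a) := by
    simp only [ae_all_iff]
    exact fun a b hab =>
      measure_eq_zero_iff_ae_notMem.1 (measure_birkhoffExceeds_inter_eq_zero hT hf hfi hab)
  filter_upwards [hosc, ae_isBoundedUnder_birkhoffAverage hT hf hfi,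
    ae_isBoundedUnder_birkhoffAverage hT hf.neg hfi.neg] with x hx hle hge
  simp only [birkhoffAverage_neg] at hge
  refine tendsto_of_no_upcrossings (s := Set.range ((↑) : ℚ → ℝ)) Rat.denseRange_cast ?_ hle
    (isBoundedUnder_le_neg.1 hge)
  rintro _ ⟨a, rfl⟩ _ ⟨b, rfl⟩ hab ⟨ha, hb⟩
  obtain ⟨a', haa', ha'b⟩ := exists_rat_btwn hab
  obtain ⟨b', hab', hb'b⟩ := exists_rat_btwn ha'b
  refine hx a' b' hab' ⟨mem_birkhoffExceeds_of_frequently hb'b (hb.mono fun n hn => hn.le),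
    mem_birkhoffExceeds_of_frequently (neg_lt_neg haa') (ha.mono fun n hn => ?_)⟩
  rw [birkhoffAverage_neg]
  exact neg_le_neg hn.le

theorem ae_exists_tendsto_birkhoffAverage (hT : MeasurePreserving T μ μ) (hf : Integrable f μ) :
    ∀ᵐ x ∂μ, ∃ l : ℝ, Tendsto (fun n => birkhoffAverage ℝ T f n x) atTop (𝓝 l) := by
  have hmk := hf.1.ae_eq_mk
  have havg (n : ℕ) := hT.quasiMeasurePreserving.birkhoffAverage_ae_eq_of_ae_eq ℝ hmk n
  filter_upwards [ae_all_iff.2 havg, ae_exists_tendsto_birkhoffAverage_of_measurable hT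
    hf.1.stronglyMeasurable_mk.measurable (hf.congr hmk)] with x hx ⟨l, hl⟩
  exact ⟨l, hl.congr fun n => (hx n).symm⟩

end PointwiseErgodicTheorem

section ExponentialGrowth

open Asymptotics

variable {E E' : Type*} [NormedAddCommGroup E] [NormedAddCommGroup E']

/-- The sequence `u` has exponential growth rate `l`: `‖u n‖ = exp (n * l + o(n))`. Since
`Real.log 0 = 0`, the zero sequence has rate `0`. -/
def HasExpGrowth (u : ℕ → E) (l : ℝ) : Prop :=
  Tendsto (fun n : ℕ => 1 / (n : ℝ) * Real.log ‖u n‖) atTop (𝓝 l)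

lemma abs_log_sub_log_le {a b c d : ℝ} (ha : 0 ≤ a) (hb : 0 ≤ b) (hc : 0 < c) (hd : 0 < d)
    (hab : a ≤ c * b) (hba : b ≤ d * a) :
    |Real.log a - Real.log b| ≤ max |Real.log c| |Real.log d| := by
  rcases ha.eq_or_lt with rfl | ha
  · obtain rfl : b = 0 := hb.antisymm' (by simpa using hba)
    simp
  · have hb : 0 < b := pos_of_mul_pos_right (ha.trans_le hab) hc.le
    have hlog_ab := Real.log_le_log ha hab
    have hlog_ba := Real.log_le_log hb hba
    rw [Real.log_mul hc.ne' hb.ne'] at hlog_ab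
    rw [Real.log_mul hd.ne' ha.ne'] at hlog_ba
    exact abs_sub_le_iff.2
      ⟨le_max_of_le_left ((sub_le_iff_le_add.2 hlog_ab).trans (le_abs_self _)),
        le_max_of_le_right ((sub_le_iff_le_add.2 hlog_ba).trans (le_abs_self _))⟩

lemma HasExpGrowth.congr_isTheta {u : ℕ → E} {w : ℕ → E'} {l : ℝ} (hu : HasExpGrowth u l)
    (huw : u =Θ[atTop] w) : HasExpGrowth w l := by
  obtain ⟨c, hc, hcw⟩ := huw.1.exists_pos
  obtain ⟨d, hd, hdu⟩ := huw.2.exists_pos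
  have hbound : ∀ᶠ n in atTop,
      |Real.log ‖w n‖ - Real.log ‖u n‖| ≤ max |Real.log c| |Real.log d| := by
    filter_upwards [hcw.bound, hdu.bound] with n huwn hwun
    rw [abs_sub_comm]
    exact abs_log_sub_log_le (norm_nonneg _) (norm_nonneg _) hc hd huwn hwun
  have hdiff :
      Tendsto (fun n : ℕ => 1 / (n : ℝ) * (Real.log ‖w n‖ - Real.log ‖u n‖)) atTop (𝓝 0) :=
    tendsto_one_div_atTop_nhds_zero_nat.zero_mul_isBoundedUnder_le
      (isBoundedUnder_of_eventually_le hbound)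
  simpa [HasExpGrowth, ← mul_add] using hu.add hdiff

lemma hasExpGrowth_zero_of_isBigO {u : ℕ → E} (hlow : (fun _ => (1 : ℝ)) =O[atTop] u)
    (hup : u =O[atTop] fun n : ℕ => (n : ℝ)) : HasExpGrowth u 0 := by
  obtain ⟨c, hc, hcu⟩ := hlow.exists_pos
  obtain ⟨d, hd, hdu⟩ := hup.exists_pos
  have hlog : Tendsto (fun n : ℕ => Real.log (n : ℝ) / (n : ℝ)) atTop (𝓝 0) :=
    (Real.isLittleO_log_id_atTop.tendsto_div_nhds_zero).comp tendsto_natCast_atTop_atTop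
  have hlower : Tendsto (fun n : ℕ => 1 / (n : ℝ) * -Real.log c) atTop (𝓝 0) := by
    simpa using tendsto_one_div_atTop_nhds_zero_nat.mul_const (-Real.log c)
  have hupper : Tendsto (fun n : ℕ => 1 / (n : ℝ) * Real.log d + Real.log (n : ℝ) / (n : ℝ))
      atTop (𝓝 0) := by
    simpa using (tendsto_one_div_atTop_nhds_zero_nat.mul_const (Real.log d)).add hlog
  refine tendsto_of_tendsto_of_tendsto_of_le_of_le' hlower hupper ?_ ?_
  · filter_upwards [hcu.bound] with n hn
    rw [norm_one] at hn
    have hlog_le := Real.log_le_log (inv_pos.2 hc) ((inv_le_iff_one_le_mul₀' hc).2 hn)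
    rw [Real.log_inv] at hlog_le
    gcongr
  · filter_upwards [hcu.bound, hdu.bound, eventually_gt_atTop 0] with n hcn hdn hn
    have hun : 0 < ‖u n‖ := by
      rw [norm_one] at hcn
      exact pos_of_mul_pos_right (one_pos.trans_le hcn) hc.le
    rw [Real.norm_natCast] at hdn
    have hlog_le := Real.log_le_log hun hdn
    rw [Real.log_mul hd.ne' (Nat.cast_ne_zero.2 hn.ne')] at hlog_le
    calc 1 / (n : ℝ) * Real.log ‖u n‖ ≤ 1 / (n : ℝ) * (Real.log d + Real.log n) := by gcongr
      _ = 1 / (n : ℝ) * Real.log d + Real.log (n : ℝ) / (n : ℝ) := by ring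

variable [NormedSpace ℝ E]

lemma hasExpGrowth_exp_smul {S : ℕ → ℝ} {l : ℝ}
    (hS : Tendsto (fun n : ℕ => (n : ℝ)⁻¹ * S n) atTop (𝓝 l)) {w : ℕ → E}
    (hw : w =Θ[atTop] fun _ => (1 : ℝ)) : HasExpGrowth (fun n => Real.exp (S n) • w n) l := by
  have hexp : HasExpGrowth (fun n => Real.exp (S n)) l := by
    simpa [HasExpGrowth] using hS
  exact hexp.congr_isTheta (by
    simpa using ((isTheta_refl (fun n => Real.exp (S n)) atTop).smul hw).symm)

lemma isTheta_of_sub_smul_isBigO_one {α : Type*} {𝓕 : Filter α} {u w : α → E} {a : ℝ}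
    (ha : a ≠ 0) (hsub : (fun n => u n - a • w n) =O[𝓕] fun _ => (1 : ℝ))
    (hu : (fun _ => (1 : ℝ)) =O[𝓕] u) (hw : (fun _ => (1 : ℝ)) =O[𝓕] w) : u =Θ[𝓕] w := by
  have haw : (fun n => a • w n) =Θ[𝓕] w :=
    (isTheta_const_smul_left ha).2 (isTheta_refl w 𝓕)
  refine ⟨?_, haw.symm.1.trans ?_⟩
  · simpa using (hsub.trans hw).add haw.1
  · simpa using (isBigO_refl u 𝓕).sub (hsub.trans hu)

end ExponentialGrowth

section Cocycle

variable {X M : Type*} [Monoid M] {φ : X → X} {A : X → M}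

/-- The cocycle over `φ` generated by `A`: the product `A (φ^[n-1] x) * ⋯ * A (φ x) * A x`. -/
def cocycle (φ : X → X) (A : X → M) : ℕ → X → M
  | 0, _ => 1
  | n + 1, x => A (φ^[n] x) * cocycle φ A n x

lemma semiconjBy_cocycle {B : X → M} {c : M} (h : ∀ x, SemiconjBy c (A x) (B x)) (n : ℕ) (x : X) :
    SemiconjBy c (cocycle φ A n x) (cocycle φ B n x) := by
  induction n with
  | zero => exact SemiconjBy.one_right c
  | succ n ih => exact (h _).mul_right ih

end Cocycle

section PositiveUnimodular

open Asymptotics Matrix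

/-- The standard area form of the plane. -/
def areaForm (v w : Fin 2 → ℝ) : ℝ := v 0 * w 1 - v 1 * w 0

lemma areaForm_mulVec (M : Matrix (Fin 2) (Fin 2) ℝ) (v w : Fin 2 → ℝ) :
    areaForm (M *ᵥ v) (M *ᵥ w) = M.det * areaForm v w := by
  simp only [areaForm, mulVec, dotProduct, Fin.sum_univ_two, det_fin_two]
  ring

lemma areaForm_smul_eq (e f v : Fin 2 → ℝ) :
    areaForm e f • v = areaForm v f • e + areaForm e v • f := by
  refine funext (Fin.forall_fin_two.2 ⟨?_, ?_⟩) <;>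
    simp only [areaForm, Pi.add_apply, Pi.smul_apply, smul_eq_mul] <;> ring

lemma areaForm_eq_sub_of_mem_stdSimplex {p q : Fin 2 → ℝ} (hp : p ∈ stdSimplex ℝ (Fin 2))
    (hq : q ∈ stdSimplex ℝ (Fin 2)) : areaForm p q = q 1 - p 1 := by
  have hp_sum := hp.2
  have hq_sum := hq.2
  simp only [Fin.sum_univ_two] at hp_sum hq_sum
  simp only [areaForm, eq_sub_of_add_eq hp_sum, eq_sub_of_add_eq hq_sum]
  ring

lemma abs_areaForm_le (v w : Fin 2 → ℝ) : |areaForm v w| ≤ 2 * (‖v‖ * ‖w‖) := by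
  have hprod (i j : Fin 2) : |v i * w j| ≤ ‖v‖ * ‖w‖ := by
    rw [abs_mul]
    exact mul_le_mul (norm_le_pi_norm v i) (norm_le_pi_norm w j) (abs_nonneg _) (norm_nonneg _)
  calc |areaForm v w| ≤ |v 0 * w 1| + |v 1 * w 0| := abs_sub _ _
    _ ≤ 2 * (‖v‖ * ‖w‖) := by linarith [hprod 0 1, hprod 1 0]

lemma one_isBigO_of_areaForm_eq {α : Type*} {𝓕 : Filter α} {u w : α → Fin 2 → ℝ} {a : ℝ}
    (ha : a ≠ 0) (harea : ∀ n, areaForm (u n) (w n) = a) (hw : w =O[𝓕] fun _ => (1 : ℝ)) :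
    (fun _ => (1 : ℝ)) =O[𝓕] u := by
  have hprod : (fun _ => a) =O[𝓕] fun n => ‖u n‖ * ‖w n‖ :=
    .of_bound 2 (.of_forall fun n => by simpa [← harea n] using abs_areaForm_le (u n) (w n))
  have hone : (fun _ => (1 : ℝ)) =O[𝓕] fun _ => a := isBigO_const_const 1 ha 𝓕
  simpa using (hone.trans hprod).trans ((isBigO_refl _ _).mul hw.norm_left)

lemma exists_hasExpGrowth_of_areaForm_ne_zero {C : ℕ → Matrix (Fin 2) (Fin 2) ℝ}
    (hC : ∀ n, (C n).det = 1) {e f v : Fin 2 → ℝ} (hef : areaForm e f ≠ 0) {l l' : ℝ}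
    (he : HasExpGrowth (fun n => C n *ᵥ e) l) (hf : HasExpGrowth (fun n => C n *ᵥ f) l')
    (he_low : (fun _ => (1 : ℝ)) =O[atTop] fun n => C n *ᵥ e)
    (hf_up : (fun n => C n *ᵥ f) =O[atTop] fun _ => (1 : ℝ)) (hv : v ≠ 0) :
    ∃ χ, HasExpGrowth (fun n => C n *ᵥ v) χ := by
  set a := (areaForm e f)⁻¹ * areaForm v f
  set b := (areaForm e f)⁻¹ * areaForm e v
  have hdecomp : v = a • e + b • f := by
    rw [mul_smul, mul_smul, ← smul_add, ← areaForm_smul_eq, inv_smul_smul₀ hef]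
  have hCv (n : ℕ) : C n *ᵥ v = a • (C n *ᵥ e) + b • (C n *ᵥ f) := by
    rw [hdecomp, mulVec_add, mulVec_smul, mulVec_smul]
  rcases eq_or_ne a 0 with ha0 | ha0
  · have hb : b ≠ 0 := by
      rintro hb
      exact hv (by rw [hdecomp, ha0, hb, zero_smul, zero_smul, add_zero])
    refine ⟨l', hf.congr_isTheta ?_⟩
    simp only [hCv, ha0, zero_smul, zero_add]
    exact (isTheta_const_smul_right hb).2 (isTheta_refl _ _)
  · have hvf : areaForm v f ≠ 0 := right_ne_zero_of_mul ha0
    have hv_low : (fun _ => (1 : ℝ)) =O[atTop] fun n => C n *ᵥ v :=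
      one_isBigO_of_areaForm_eq hvf (fun n => by rw [areaForm_mulVec, hC, one_mul]) hf_up
    refine ⟨l, he.congr_isTheta (isTheta_of_sub_smul_isBigO_one ha0 ?_ hv_low he_low).symm⟩
    simp only [hCv, add_sub_cancel_left]
    exact hf_up.const_smul_left b

lemma isTheta_one_of_mem_stdSimplex {α ι : Type*} [Fintype ι] {𝓕 : Filter α} {p : α → ι → ℝ}
    (hp : ∀ n, p n ∈ stdSimplex ℝ ι) : p =Θ[𝓕] fun _ => (1 : ℝ) := by
  refine ⟨.of_bound 1 (.of_forall fun n => ?_),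
    .of_bound (Fintype.card ι) (.of_forall fun n => ?_)⟩
  · rw [norm_one, mul_one, pi_norm_le_iff_of_nonneg zero_le_one]
    intro i
    rw [Real.norm_of_nonneg ((hp n).1 i)]
    exact mem_Icc_of_mem_stdSimplex (hp n) i |>.2
  · calc ‖(1 : ℝ)‖ = ∑ i, p n i := by rw [norm_one, (hp n).2]
      _ ≤ ∑ _i : ι, ‖p n‖ := Finset.sum_le_sum fun i _ =>
          (Real.le_norm_self _).trans (norm_le_pi_norm (p n) i)
      _ = Fintype.card ι * ‖p n‖ := by simp

/-- A matrix of determinant one with nonnegative entries, those on the diagonal being at least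
one. Such are the derivatives of compositions of positive horizontal and vertical shears. -/
structure IsPositiveUnimodular (M : Matrix (Fin 2) (Fin 2) ℝ) : Prop where
  nonneg : ∀ i j, 0 ≤ M i j
  one_le_diag : ∀ i, 1 ≤ M i i
  det_eq_one : M.det = 1

lemma transvection_mul_transvection_eq {R : Type*} [CommRing R] (a b : R) :
    transvection 1 0 b * transvection 0 1 a = !![1, a; b, 1 + b * a] := by
  ext i j
  fin_cases i <;> fin_cases j <;> simp [transvection, mul_apply, single_apply, add_comm]

lemma isPositiveUnimodular_transvection_mul_transvection {a b : ℝ} (ha : 0 ≤ a) (hb : 0 ≤ b) :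
    IsPositiveUnimodular (transvection 1 0 b * transvection 0 1 a) where
  nonneg := by
    simpa [transvection_mul_transvection_eq, Fin.forall_fin_two] using
      ⟨ha, hb, add_nonneg zero_le_one (mul_nonneg hb ha)⟩
  one_le_diag := by
    simpa [transvection_mul_transvection_eq, Fin.forall_fin_two] using mul_nonneg hb ha
  det_eq_one := by
    rw [det_mul, det_transvection_of_ne _ _ one_ne_zero, det_transvection_of_ne _ _ zero_ne_one,
      one_mul]

/-- The factor by which `M` stretches the `ℓ¹` norm of a vector `p` of the standard simplex. -/
def stretch (M : Matrix (Fin 2) (Fin 2) ℝ) (p : Fin 2 → ℝ) : ℝ := ∑ i, (M *ᵥ p) i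

/-- The projective action of a nonnegative matrix `M` on directions in the first quadrant, which
are represented by points of the standard simplex. -/
noncomputable def projAct (M : Matrix (Fin 2) (Fin 2) ℝ) (p : Fin 2 → ℝ) : Fin 2 → ℝ :=
  (stretch M p)⁻¹ • (M *ᵥ p)

namespace IsPositiveUnimodular

variable {M : Matrix (Fin 2) (Fin 2) ℝ} {p : Fin 2 → ℝ}

lemma one_le_stretch (hM : IsPositiveUnimodular M) (hp : p ∈ stdSimplex ℝ (Fin 2)) :
    1 ≤ stretch M p := by
  have hsum := hp.2
  simp only [stretch, mulVec, dotProduct, Fin.sum_univ_two] at hsum ⊢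
  nlinarith [hp.1 0, hp.1 1, mul_nonneg (hM.nonneg 1 0) (hp.1 0),
    mul_nonneg (hM.nonneg 0 1) (hp.1 1), mul_le_mul_of_nonneg_right (hM.one_le_diag 0) (hp.1 0),
    mul_le_mul_of_nonneg_right (hM.one_le_diag 1) (hp.1 1)]

lemma stretch_le_sum (hM : IsPositiveUnimodular M) (hp : p ∈ stdSimplex ℝ (Fin 2)) :
    stretch M p ≤ ∑ i, ∑ j, M i j := by
  simp only [stretch, mulVec, dotProduct]
  exact Finset.sum_le_sum fun i _ => Finset.sum_le_sum fun j _ =>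
    mul_le_of_le_one_right (hM.nonneg i j) (mem_Icc_of_mem_stdSimplex hp j).2

lemma stretch_pos (hM : IsPositiveUnimodular M) (hp : p ∈ stdSimplex ℝ (Fin 2)) :
    0 < stretch M p :=
  one_pos.trans_le (hM.one_le_stretch hp)

lemma stretch_smul_projAct (hM : IsPositiveUnimodular M) (hp : p ∈ stdSimplex ℝ (Fin 2)) :
    stretch M p • projAct M p = M *ᵥ p :=
  smul_inv_smul₀ (hM.stretch_pos hp).ne' _

lemma projAct_mem_stdSimplex (hM : IsPositiveUnimodular M) (hp : p ∈ stdSimplex ℝ (Fin 2)) :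
    projAct M p ∈ stdSimplex ℝ (Fin 2) := by
  refine ⟨fun i => mul_nonneg (inv_nonneg.2 (hM.stretch_pos hp).le) ?_, ?_⟩
  · exact dotProduct_nonneg_of_nonneg (hM.nonneg i) hp.1
  · simp only [projAct, Pi.smul_apply, smul_eq_mul, ← Finset.mul_sum]
    exact inv_mul_cancel₀ (hM.stretch_pos hp).ne'

lemma continuousAt_projAct (hM : IsPositiveUnimodular M) (hp : p ∈ stdSimplex ℝ (Fin 2)) :
    ContinuousAt (projAct M) p := by
  have hmul : Continuous fun p => M *ᵥ p := by fun_prop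
  have hstretch : Continuous (stretch M) := by unfold stretch; fun_prop
  exact (hstretch.continuousAt.inv₀ (hM.stretch_pos hp).ne').smul hmul.continuousAt

/-- A positive determinant preserves the orientation, hence the order of directions. -/
lemma projAct_apply_one_mono {q : Fin 2 → ℝ} (hM : IsPositiveUnimodular M)
    (hp : p ∈ stdSimplex ℝ (Fin 2)) (hq : q ∈ stdSimplex ℝ (Fin 2)) (hpq : p 1 ≤ q 1) :
    projAct M p 1 ≤ projAct M q 1 := by
  rw [← sub_nonneg, ← areaForm_eq_sub_of_mem_stdSimplex (hM.projAct_mem_stdSimplex hp)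
    (hM.projAct_mem_stdSimplex hq)]
  have harea : areaForm (projAct M p) (projAct M q) =
      (stretch M p)⁻¹ * (stretch M q)⁻¹ * (q 1 - p 1) := by
    rw [← areaForm_eq_sub_of_mem_stdSimplex hp hq, ← one_mul (areaForm p q), ← hM.det_eq_one,
      ← areaForm_mulVec]
    simp only [areaForm, projAct, Pi.smul_apply, smul_eq_mul]
    ring
  rw [harea]
  have hp_pos := hM.stretch_pos hp
  have hq_pos := hM.stretch_pos hq
  have := sub_nonneg.2 hpq
  positivity

end IsPositiveUnimodular

end PositiveUnimodular

section PositiveCocycles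

open Asymptotics Matrix

section Growth

variable {X ι : Type*} [Fintype ι] [DecidableEq ι] {φ : X → X} {A : X → Matrix ι ι ℝ}
  {c : X → ℝ} {w : X → ι → ℝ}

lemma det_cocycle {R : Type*} [CommRing R] {A : X → Matrix ι ι R} (hA : ∀ x, (A x).det = 1)
    (n : ℕ) (x : X) : (cocycle φ A n x).det = 1 := by
  induction n with
  | zero => exact det_one
  | succ n ih => rw [cocycle, det_mul, hA, ih, one_mul]

lemma cocycle_mulVec_eq_exp_smul (hc : ∀ x, 0 < c x) (hw : ∀ x, A x *ᵥ w x = c x • w (φ x))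
    (n : ℕ) (x : X) : cocycle φ A n x *ᵥ w x =
      Real.exp (birkhoffSum φ (fun y => Real.log (c y)) n x) • w (φ^[n] x) := by
  induction n with
  | zero => simp [cocycle]
  | succ n ih =>
    rw [cocycle, ← mulVec_mulVec, ih, mulVec_smul, hw, smul_smul, birkhoffSum_succ, Real.exp_add,
      Real.exp_log (hc _), Function.iterate_succ_apply']

lemma hasExpGrowth_cocycle_mulVec (hc : ∀ x, 0 < c x) (hw : ∀ x, A x *ᵥ w x = c x • w (φ x))
    {x : X} (hw_one : (fun n => w (φ^[n] x)) =Θ[atTop] fun _ => (1 : ℝ)) {l : ℝ}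
    (hl : Tendsto (fun n => birkhoffAverage ℝ φ (fun y => Real.log (c y)) n x) atTop (𝓝 l)) :
    HasExpGrowth (fun n => cocycle φ A n x *ᵥ w x) l := by
  simp only [cocycle_mulVec_eq_exp_smul hc hw]
  exact hasExpGrowth_exp_smul hl hw_one

lemma one_isBigO_cocycle_mulVec (hc : ∀ x, 1 ≤ c x) (hw : ∀ x, A x *ᵥ w x = c x • w (φ x))
    {x : X} (hw_one : (fun n => w (φ^[n] x)) =Θ[atTop] fun _ => (1 : ℝ)) :
    (fun _ => (1 : ℝ)) =O[atTop] fun n => cocycle φ A n x *ᵥ w x := by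
  simp only [cocycle_mulVec_eq_exp_smul (fun x => one_pos.trans_le (hc x)) hw]
  have hexp : (fun _ => (1 : ℝ)) =O[atTop]
      fun n => Real.exp (birkhoffSum φ (fun y => Real.log (c y)) n x) :=
    isBigO_of_le _ fun n => by
      rw [norm_one, Real.norm_of_nonneg (Real.exp_pos _).le, Real.one_le_exp_iff]
      exact Finset.sum_nonneg fun _ _ => Real.log_nonneg (hc _)
  simpa using hexp.smul hw_one.2

lemma cocycle_mulVec_isBigO_one (hc : ∀ x, 0 < c x) (hc_le : ∀ x, c x ≤ 1)
    (hw : ∀ x, A x *ᵥ w x = c x • w (φ x))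
    {x : X} (hw_one : (fun n => w (φ^[n] x)) =Θ[atTop] fun _ => (1 : ℝ)) :
    (fun n => cocycle φ A n x *ᵥ w x) =O[atTop] fun _ => (1 : ℝ) := by
  simp only [cocycle_mulVec_eq_exp_smul hc hw]
  have hexp : (fun n => Real.exp (birkhoffSum φ (fun y => Real.log (c y)) n x)) =O[atTop]
      fun _ => (1 : ℝ) :=
    isBigO_of_le _ fun n => by
      rw [norm_one, Real.norm_of_nonneg (Real.exp_pos _).le, Real.exp_le_one_iff]
      exact Finset.sum_nonpos fun _ _ => Real.log_nonpos (hc _).le (hc_le _)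
  simpa using hexp.smul hw_one.1

lemma transvection_mulVec {R : Type*} [CommRing R] (i j : ι) (a : R) (v : ι → R) :
    transvection i j a *ᵥ v = v + (a * v j) • Pi.single i 1 := by
  ext k
  simp [transvection, add_mulVec, single_mulVec, Pi.single_apply, Function.update_apply]

lemma hasExpGrowth_transvection_mulVec {i j : ι} (hij : i ≠ j) {a : ℕ → ℝ}
    (ha : a =O[atTop] fun n : ℕ => (n : ℝ)) {v : ι → ℝ} (hv : v ≠ 0) :
    HasExpGrowth (fun n => transvection i j (a n) *ᵥ v) 0 := by
  have hconst : (fun _ => v) =O[atTop] fun n : ℕ => (n : ℝ) :=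
    (isLittleO_const_left.2
      (.inr (tendsto_norm_atTop_atTop.comp tendsto_natCast_atTop_atTop))).isBigO
  simp only [transvection_mulVec]
  refine hasExpGrowth_zero_of_isBigO ?_ ?_
  · rcases eq_or_ne (v j) 0 with hvj | hvj
    · simp only [hvj, mul_zero, zero_smul, add_zero]
      exact isBigO_const_const 1 hv atTop
    · refine (isBigO_const_const 1 hvj atTop).trans (isBigO_of_le _ fun n => ?_)
      simpa [Pi.single_eq_of_ne hij.symm] using
        norm_le_pi_norm (v + (a n * v j) • (Pi.single i 1 : ι → ℝ)) j
  · refine hconst.add (((isBigO_refl a atTop).mul (isBigO_const_const (v j) one_ne_zero _)).smul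
      (isBigO_const_const (Pi.single i 1) (one_ne_zero (α := ℝ)) _) |>.trans ?_)
    simpa using ha

end Growth

section InvariantDirections

variable {X : Type*} {φ : Equiv.Perm X} {A : X → Matrix (Fin 2) (Fin 2) ℝ}

/-- The direction at `x` obtained by pushing forward the first coordinate axis from the point
`φ⁻¹ ^ n x` of the past. -/
noncomputable def pastDirection (φ : Equiv.Perm X) (A : X → Matrix (Fin 2) (Fin 2) ℝ) :
    ℕ → X → Fin 2 → ℝ
  | 0, _ => Pi.single 0 1
  | n + 1, x => projAct (A (φ⁻¹ x)) (pastDirection φ A n (φ⁻¹ x))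

lemma pastDirection_mem_stdSimplex (hA : ∀ x, IsPositiveUnimodular (A x)) (n : ℕ) (x : X) :
    pastDirection φ A n x ∈ stdSimplex ℝ (Fin 2) := by
  induction n generalizing x with
  | zero => exact single_mem_stdSimplex ℝ 0
  | succ n ih => exact (hA _).projAct_mem_stdSimplex (ih _)

lemma pastDirection_apply_one_le_succ (hA : ∀ x, IsPositiveUnimodular (A x)) (n : ℕ) (x : X) :
    pastDirection φ A n x 1 ≤ pastDirection φ A (n + 1) x 1 := by
  induction n generalizing x with
  | zero => exact (pastDirection_mem_stdSimplex hA 1 x).1 1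
  | succ n ih =>
    exact (hA _).projAct_apply_one_mono (pastDirection_mem_stdSimplex hA n _)
      (pastDirection_mem_stdSimplex hA (n + 1) _) (ih _)

lemma exists_tendsto_pastDirection (hA : ∀ x, IsPositiveUnimodular (A x)) (x : X) :
    ∃ e, Tendsto (fun n => pastDirection φ A n x) atTop (𝓝 e) := by
  have hmem (n : ℕ) := pastDirection_mem_stdSimplex (φ := φ) hA n x
  have hlim := tendsto_atTop_ciSup (monotone_nat_of_le_succ fun n =>
    pastDirection_apply_one_le_succ (φ := φ) hA n x)
    ⟨1, Set.forall_mem_range.2 fun n => (mem_Icc_of_mem_stdSimplex (hmem n) 1).2⟩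
  refine ⟨![1 - ⨆ n, pastDirection φ A n x 1, ⨆ n, pastDirection φ A n x 1],
    tendsto_pi_nhds.2 (Fin.forall_fin_two.2 ⟨?_, hlim⟩)⟩
  refine (hlim.const_sub 1).congr fun n => ?_
  rw [← (hmem n).2, Fin.sum_univ_two, add_sub_cancel_right]

variable [MeasurableSpace X]

lemma measurable_mulVec {ι κ : Type*} [Fintype ι] {B : X → Matrix κ ι ℝ} {p : X → ι → ℝ}
    (hB : ∀ i j, Measurable fun x => B x i j) (hp : Measurable p) :
    Measurable fun x => B x *ᵥ p x :=
  measurable_pi_iff.2 fun i => Finset.measurable_fun_sum _ fun j _ =>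
    (hB i j).mul ((measurable_pi_apply j).comp hp)

lemma measurable_stretch {B : X → Matrix (Fin 2) (Fin 2) ℝ} {p : X → Fin 2 → ℝ}
    (hB : ∀ i j, Measurable fun x => B x i j) (hp : Measurable p) :
    Measurable fun x => stretch (B x) (p x) :=
  Finset.measurable_fun_sum _ fun i _ => (measurable_pi_apply i).comp (measurable_mulVec hB hp)

lemma measurable_pastDirection (hφ : Measurable (φ⁻¹ : Equiv.Perm X))
    (hA : ∀ i j, Measurable fun x => A x i j) (n : ℕ) : Measurable (pastDirection φ A n) := by
  induction n with
  | zero => exact measurable_const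
  | succ n ih =>
    have hA_past (i j : Fin 2) := (hA i j).comp hφ
    have hp_past := ih.comp hφ
    exact (measurable_stretch hA_past hp_past).inv.smul (measurable_mulVec hA_past hp_past)

theorem exists_measurable_invariant_direction (hφ : Measurable (φ⁻¹ : Equiv.Perm X))
    (hA : ∀ x, IsPositiveUnimodular (A x)) (hAm : ∀ i j, Measurable fun x => A x i j) :
    ∃ e : X → Fin 2 → ℝ, Measurable e ∧ (∀ x, e x ∈ stdSimplex ℝ (Fin 2)) ∧
      ∀ x, projAct (A x) (e x) = e (φ x) := by
  choose e he using exists_tendsto_pastDirection (φ := φ) hA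
  have hmem (x : X) : e x ∈ stdSimplex ℝ (Fin 2) :=
    (isClosed_stdSimplex ℝ (Fin 2)).mem_of_tendsto (he x)
      (.of_forall fun n => pastDirection_mem_stdSimplex hA n x)
  refine ⟨e, measurable_of_tendsto_metrizable (measurable_pastDirection hφ hAm)
    (tendsto_pi_nhds.2 he), hmem, fun x => ?_⟩
  refine tendsto_nhds_unique (((hA x).continuousAt_projAct (hmem x)).tendsto.comp (he x)) ?_
  refine ((tendsto_add_atTop_iff_nat 1).2 (he (φ x))).congr fun n => ?_
  simp [pastDirection]

/-- The reflection that exchanges the first and the second quadrant. -/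
def axisReflection : Matrix (Fin 2) (Fin 2) ℝ := !![-1, 0; 0, 1]

/-- For `M` of determinant one, the conjugate of `M⁻¹` by `axisReflection`: unlike `M⁻¹` it has
nonnegative entries when `M` does. -/
def reflectedInv (M : Matrix (Fin 2) (Fin 2) ℝ) : Matrix (Fin 2) (Fin 2) ℝ :=
  of fun i j => M j.rev i.rev

lemma norm_axisReflection_mulVec (v : Fin 2 → ℝ) : ‖axisReflection *ᵥ v‖ = ‖v‖ := by
  simp [axisReflection, Pi.norm_def, Fin.univ_succ, vecHead, vecTail]

variable {M : Matrix (Fin 2) (Fin 2) ℝ}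

lemma IsPositiveUnimodular.reflectedInv (hM : IsPositiveUnimodular M) :
    IsPositiveUnimodular (reflectedInv M) where
  nonneg _ _ := hM.nonneg _ _
  one_le_diag _ := hM.one_le_diag _
  det_eq_one := by
    rw [← hM.det_eq_one, det_fin_two, det_fin_two]
    simp [_root_.reflectedInv, mul_comm]

lemma semiconjBy_axisReflection_inv (hM : M.det = 1) :
    SemiconjBy axisReflection M⁻¹ (reflectedInv M) := by
  rw [inv_def, hM, Ring.inverse_one, one_smul, adjugate_fin_two, SemiconjBy]
  ext i j
  fin_cases i <;> fin_cases j <;> simp [axisReflection, reflectedInv, mul_apply]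

lemma mulVec_axisReflection_mulVec_reflectedInv (hM : M.det = 1) (v : Fin 2 → ℝ) :
    M *ᵥ axisReflection *ᵥ reflectedInv M *ᵥ v = axisReflection *ᵥ v := by
  rw [mulVec_mulVec, mulVec_mulVec]
  congr 1
  rw [det_fin_two] at hM
  ext i j
  fin_cases i <;> fin_cases j <;> simp [axisReflection, reflectedInv, mul_apply] <;> linarith

theorem exists_measurable_expanded_direction (hφ : Measurable (φ⁻¹ : Equiv.Perm X))
    (hA : ∀ x, IsPositiveUnimodular (A x)) (hAm : ∀ i j, Measurable fun x => A x i j) :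
    ∃ e : X → Fin 2 → ℝ, Measurable e ∧ (∀ x, e x ∈ stdSimplex ℝ (Fin 2)) ∧
      ∀ x, A x *ᵥ e x = stretch (A x) (e x) • e (φ x) := by
  obtain ⟨e, he, hmem, hinv⟩ := exists_measurable_invariant_direction hφ hA hAm
  refine ⟨e, he, hmem, fun x => ?_⟩
  rw [← hinv, (hA x).stretch_smul_projAct (hmem x)]

theorem exists_measurable_contracted_direction (hφ : Measurable φ)
    (hφ_inv : Measurable (φ⁻¹ : Equiv.Perm X)) (hA : ∀ x, IsPositiveUnimodular (A x))
    (hAm : ∀ i j, Measurable fun x => A x i j) :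
    ∃ p : X → Fin 2 → ℝ, Measurable p ∧ (∀ x, p x ∈ stdSimplex ℝ (Fin 2)) ∧
      ∀ x, A x *ᵥ axisReflection *ᵥ p x =
        (stretch (reflectedInv (A x)) (p (φ x)))⁻¹ • axisReflection *ᵥ p (φ x) := by
  obtain ⟨p, hp, hmem, hinv⟩ := exists_measurable_invariant_direction (φ := φ⁻¹)
    (A := fun x => reflectedInv (A (φ⁻¹ x))) (by simpa using hφ) (fun x => (hA _).reflectedInv)
    (fun i j => (hAm j.rev i.rev).comp hφ_inv)
  refine ⟨p, hp, hmem, fun x => ?_⟩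
  have hpx : projAct (reflectedInv (A x)) (p (φ x)) = p x := by simpa using hinv (φ x)
  rw [← hpx, projAct, mulVec_smul, mulVec_smul,
    mulVec_axisReflection_mulVec_reflectedInv (hA x).det_eq_one]

end InvariantDirections

section Degenerate

lemma exists_eq_single_of_areaForm_axisReflection_eq_zero {e p : Fin 2 → ℝ}
    (he : e ∈ stdSimplex ℝ (Fin 2)) (hp : p ∈ stdSimplex ℝ (Fin 2))
    (harea : areaForm e (axisReflection *ᵥ p) = 0) : ∃ i, e = Pi.single i 1 := by
  have he_sum := he.2
  have hp_sum := hp.2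
  rw [Fin.sum_univ_two] at he_sum hp_sum
  have hzero : e 0 * p 1 + e 1 * p 0 = 0 := by
    simpa [areaForm, axisReflection, vecHead, vecTail] using harea
  obtain ⟨h01, h10⟩ := (add_eq_zero_iff_of_nonneg (mul_nonneg (he.1 0) (hp.1 1))
    (mul_nonneg (he.1 1) (hp.1 0))).1 hzero
  rcases mul_eq_zero.1 h10 with he1 | hp0
  · have he0 : e 0 = 1 := by linarith
    exact ⟨0, funext (Fin.forall_fin_two.2 ⟨by simpa using he0, by simpa using he1⟩)⟩
  · have hp1 : p 1 = 1 := by linarith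
    have he0 : e 0 = 0 := by rwa [hp1, mul_one] at h01
    have he1 : e 1 = 1 := by linarith
    exact ⟨1, funext (Fin.forall_fin_two.2 ⟨by simpa using he0, by simpa using he1⟩)⟩

lemma areaForm_iterate_eq_zero {X : Type*} {φ : X → X} {A : X → Matrix (Fin 2) (Fin 2) ℝ}
    {r s : X → ℝ} {e f : X → Fin 2 → ℝ} (hr : ∀ x, r x ≠ 0)
    (hs : ∀ x, s x ≠ 0) (he : ∀ x, A x *ᵥ e x = r x • e (φ x))
    (hf : ∀ x, A x *ᵥ f x = s x • f (φ x)) {x : X} (hx : areaForm (e x) (f x) = 0) (n : ℕ) :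
    areaForm (e (φ^[n] x)) (f (φ^[n] x)) = 0 := by
  induction n with
  | zero => exact hx
  | succ n ih =>
    set y := φ^[n] x
    have hscale : areaForm (A y *ᵥ e y) (A y *ᵥ f y) =
        r y * s y * areaForm (e (φ y)) (f (φ y)) := by
      simp only [he, hf, areaForm, Pi.smul_apply, smul_eq_mul]
      ring
    rw [areaForm_mulVec, ih, mul_zero] at hscale
    rw [Function.iterate_succ_apply']
    exact (mul_eq_zero.1 hscale.symm).resolve_left (mul_ne_zero (hr y) (hs y))

lemma IsPositiveUnimodular.eq_transvection {M : Matrix (Fin 2) (Fin 2) ℝ}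
    (hM : IsPositiveUnimodular M) {i j : Fin 2} (hij : i ≠ j) (hji : M j i = 0) :
    M = transvection i j (M i j) := by
  have hdiag : M 0 0 * M 1 1 = 1 := by
    have hoff : M 0 1 * M 1 0 = 0 := by fin_cases i <;> fin_cases j <;> simp_all
    rw [← hM.det_eq_one, det_fin_two, hoff, sub_zero]
  have h0 := hM.one_le_diag 0
  have h1 := hM.one_le_diag 1
  have h00 : M 0 0 = 1 := by nlinarith
  have h11 : M 1 1 = 1 := by nlinarith
  ext k l
  fin_cases i <;> fin_cases j <;> fin_cases k <;> fin_cases l <;>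
    simp_all [transvection]

lemma cocycle_eq_transvection {X ι R : Type*} [Fintype ι] [DecidableEq ι] [CommRing R]
    {φ : X → X} {A : X → Matrix ι ι R} {x : X} {i j : ι} (hij : i ≠ j) {a : X → R}
    (hA : ∀ n, A (φ^[n] x) = transvection i j (a (φ^[n] x))) (n : ℕ) :
    cocycle φ A n x = transvection i j (birkhoffSum φ a n x) := by
  induction n with
  | zero => simp [cocycle]
  | succ n ih =>
    rw [cocycle, hA, ih, transvection_mul_transvection_same _ _ hij, birkhoffSum_succ, add_comm]

lemma exists_cocycle_eq_transvection {X : Type*} {φ : X → X} {A : X → Matrix (Fin 2) (Fin 2) ℝ}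
    (hA : ∀ x, IsPositiveUnimodular (A x)) {r : X → ℝ} {e : X → Fin 2 → ℝ}
    (he : ∀ x, A x *ᵥ e x = r x • e (φ x)) {x : X}
    (hvertex : ∀ n, ∃ i, e (φ^[n] x) = Pi.single i 1) :
    ∃ i j, i ≠ j ∧ ∀ n,
      cocycle φ A n x = transvection i j (birkhoffSum φ (fun y => A y i j) n x) := by
  obtain ⟨i, hi⟩ := hvertex 0
  obtain ⟨j, hji⟩ := exists_ne i
  have hstep {n : ℕ} (hn : e (φ^[n] x) = Pi.single i 1) :
      e (φ^[n + 1] x) = Pi.single i 1 ∧ A (φ^[n] x) j i = 0 := by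
    obtain ⟨k, hk⟩ := hvertex (n + 1)
    have himage := he (φ^[n] x)
    rw [← Function.iterate_succ_apply' φ, hn, hk, mulVec_single_one] at himage
    have hki : k = i := by
      by_contra hki
      have hzero : A (φ^[n] x) i i = 0 := by simpa [Ne.symm hki] using congrFun himage i
      linarith [(hA (φ^[n] x)).one_le_diag i]
    subst hki
    exact ⟨hk, by simpa [hji] using congrFun himage j⟩
  have he_const (n : ℕ) : e (φ^[n] x) = Pi.single i 1 := by
    induction n with
    | zero => exact hi
    | succ n ih => exact (hstep ih).1
  exact ⟨i, j, hji.symm, cocycle_eq_transvection hji.symm fun n =>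
    (hA _).eq_transvection hji.symm (hstep (he_const n)).2⟩

end Degenerate

section Rates

variable {X : Type*} {A : X → Matrix (Fin 2) (Fin 2) ℝ}

lemma exists_hasExpGrowth_cocycle_of_transverse {φ : X → X}
    (hA : ∀ x, (A x).det = 1)
    {r s : X → ℝ} {e f : X → Fin 2 → ℝ} (hr : ∀ x, 1 ≤ r x) (hs : ∀ x, 0 < s x)
    (hs_le : ∀ x, s x ≤ 1) (he : ∀ x, A x *ᵥ e x = r x • e (φ x))
    (hf : ∀ x, A x *ᵥ f x = s x • f (φ x)) {x : X}
    (he_one : (fun n => e (φ^[n] x)) =Θ[atTop] fun _ => (1 : ℝ))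
    (hf_one : (fun n => f (φ^[n] x)) =Θ[atTop] fun _ => (1 : ℝ)) {l l' : ℝ}
    (hl : Tendsto (fun n => birkhoffAverage ℝ φ (fun y => Real.log (r y)) n x) atTop (𝓝 l))
    (hl' : Tendsto (fun n => birkhoffAverage ℝ φ (fun y => Real.log (s y)) n x) atTop (𝓝 l'))
    (harea : areaForm (e x) (f x) ≠ 0) {v : Fin 2 → ℝ} (hv : v ≠ 0) :
    ∃ χ, HasExpGrowth (fun n => cocycle φ A n x *ᵥ v) χ :=
  exists_hasExpGrowth_of_areaForm_ne_zero (det_cocycle hA · x) harea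
    (hasExpGrowth_cocycle_mulVec (fun x => one_pos.trans_le (hr x)) he he_one hl)
    (hasExpGrowth_cocycle_mulVec hs hf hf_one hl')
    (one_isBigO_cocycle_mulVec hr he he_one) (cocycle_mulVec_isBigO_one hs hs_le hf hf_one) hv

lemma hasExpGrowth_cocycle_zero_of_not_transverse {φ : X → X}
    (hA : ∀ x, IsPositiveUnimodular (A x))
    {r s : X → ℝ} {e p : X → Fin 2 → ℝ} (hr : ∀ x, r x ≠ 0) (hs : ∀ x, s x ≠ 0)
    (he_mem : ∀ x, e x ∈ stdSimplex ℝ (Fin 2)) (hp_mem : ∀ x, p x ∈ stdSimplex ℝ (Fin 2))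
    (he : ∀ x, A x *ᵥ e x = r x • e (φ x))
    (hp : ∀ x, A x *ᵥ axisReflection *ᵥ p x = s x • axisReflection *ᵥ p (φ x)) {x : X}
    (hlim : ∀ i j, ∃ l, Tendsto (fun n => birkhoffAverage ℝ φ (fun y => A y i j) n x) atTop (𝓝 l))
    (harea : areaForm (e x) (axisReflection *ᵥ p x) = 0) {v : Fin 2 → ℝ} (hv : v ≠ 0) :
    HasExpGrowth (fun n => cocycle φ A n x *ᵥ v) 0 := by
  obtain ⟨i, j, hij, hcocycle⟩ := exists_cocycle_eq_transvection hA he fun n =>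
    exists_eq_single_of_areaForm_axisReflection_eq_zero (he_mem _) (hp_mem _)
      (areaForm_iterate_eq_zero hr hs he hp harea n)
  obtain ⟨_, hl⟩ := hlim i j
  simp only [hcocycle]
  exact hasExpGrowth_transvection_mulVec hij (birkhoffSum_isBigO_natCast hl) hv

variable [MeasurableSpace X] {μ : Measure X}

lemma integrable_log_stretch {B : X → Matrix (Fin 2) (Fin 2) ℝ}
    (hB : ∀ x, IsPositiveUnimodular (B x)) (hBi : ∀ i j, Integrable (fun x => B x i j) μ)
    (hBm : ∀ i j, Measurable fun x => B x i j) {p : X → Fin 2 → ℝ} (hp : Measurable p)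
    (hp_mem : ∀ x, p x ∈ stdSimplex ℝ (Fin 2)) :
    Integrable (fun x => Real.log (stretch (B x) (p x))) μ := by
  have hsum : Integrable (fun x => ∑ i, ∑ j, B x i j) μ :=
    integrable_finsetSum _ fun i _ => integrable_finsetSum _ fun j _ => hBi i j
  refine hsum.mono' (measurable_stretch hBm hp).log.aestronglyMeasurable (.of_forall fun x => ?_)
  rw [Real.norm_of_nonneg (Real.log_nonneg ((hB x).one_le_stretch (hp_mem x)))]
  exact (Real.log_le_self ((hB x).stretch_pos (hp_mem x)).le).trans
    ((hB x).stretch_le_sum (hp_mem x))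

variable {φ : Equiv.Perm X}

theorem ae_forall_exists_hasExpGrowth [IsFiniteMeasure μ] (hφ : MeasurePreserving φ μ μ)
    (hφ_inv : Measurable (φ⁻¹ : Equiv.Perm X)) (hA : ∀ x, IsPositiveUnimodular (A x))
    (hAm : ∀ i j, Measurable fun x => A x i j) (hAi : ∀ i j, Integrable (fun x => A x i j) μ) :
    ∀ᵐ x ∂μ, ∀ v ≠ 0, ∃ l, HasExpGrowth (fun n => cocycle φ A n x *ᵥ v) l := by
  obtain ⟨e, he_meas, he_mem, he⟩ := exists_measurable_expanded_direction hφ_inv hA hAm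
  obtain ⟨p, hp_meas, hp_mem, hp⟩ :=
    exists_measurable_contracted_direction hφ.measurable hφ_inv hA hAm
  have hr (x : X) := (hA x).one_le_stretch (he_mem x)
  have hs (x : X) := inv_pos.2 ((hA x).reflectedInv.stretch_pos (hp_mem (φ x)))
  have hs_le (x : X) := inv_le_one_of_one_le₀ ((hA x).reflectedInv.one_le_stretch (hp_mem (φ x)))
  have he_int := integrable_log_stretch hA hAi hAm he_meas he_mem
  have hp_int :
      Integrable (fun x => Real.log (stretch (reflectedInv (A x)) (p (φ x)))⁻¹) μ := by
    simp only [Real.log_inv]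
    exact (integrable_log_stretch (fun x => (hA x).reflectedInv) (fun i j => hAi j.rev i.rev)
      (fun i j => hAm j.rev i.rev) (hp_meas.comp hφ.measurable) fun x => hp_mem (φ x)).neg
  filter_upwards [ae_exists_tendsto_birkhoffAverage hφ he_int,
    ae_exists_tendsto_birkhoffAverage hφ hp_int,
    ae_all_iff.2 fun i => ae_all_iff.2 fun j => ae_exists_tendsto_birkhoffAverage hφ (hAi i j)]
    with x ⟨l, hl⟩ ⟨l', hl'⟩ hlim v hv
  by_cases harea : areaForm (e x) (axisReflection *ᵥ p x) = 0
  · exact ⟨0, hasExpGrowth_cocycle_zero_of_not_transverse hA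
      (fun x => (one_pos.trans_le (hr x)).ne') (fun x => (hs x).ne') he_mem hp_mem he hp hlim
      harea hv⟩
  · have hp_one : (fun n => axisReflection *ᵥ p (φ^[n] x)) =Θ[atTop] fun _ => (1 : ℝ) := by
      rw [← isTheta_norm_left]
      simpa only [norm_axisReflection_mulVec, isTheta_norm_left] using
        isTheta_one_of_mem_stdSimplex fun n => hp_mem (φ^[n] x)
    exact exists_hasExpGrowth_cocycle_of_transverse (fun x => (hA x).det_eq_one) hr hs hs_le he hp
      (isTheta_one_of_mem_stdSimplex fun n => he_mem _) hp_one hl hl' harea hv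

theorem ae_forall_exists_hasExpGrowth_inv [IsFiniteMeasure μ] (hφ : MeasurePreserving φ μ μ)
    (hφ_inv : Measurable (φ⁻¹ : Equiv.Perm X)) (hA : ∀ x, IsPositiveUnimodular (A x))
    (hAm : ∀ i j, Measurable fun x => A x i j) (hAi : ∀ i j, Integrable (fun x => A x i j) μ) :
    ∀ᵐ x ∂μ, ∀ v ≠ 0, ∃ l, HasExpGrowth
      (fun n => cocycle (φ⁻¹ : Equiv.Perm X) (fun y => (A (φ⁻¹ y))⁻¹) n x *ᵥ v) l := by
  have hφ' : MeasurePreserving (φ⁻¹ : Equiv.Perm X) μ μ :=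
    MeasurePreserving.symm ⟨φ, hφ.measurable, hφ_inv⟩ hφ
  filter_upwards [ae_forall_exists_hasExpGrowth hφ' (by simpa using hφ.measurable)
    (fun x => (hA (φ⁻¹ x)).reflectedInv)
    (fun i j => (hAm j.rev i.rev).comp hφ_inv)
    (fun i j => hφ'.integrable_comp_of_integrable (hAi j.rev i.rev))] with x hx v hv
  have hv' : axisReflection *ᵥ v ≠ 0 := by
    rwa [← norm_ne_zero_iff, norm_axisReflection_mulVec, norm_ne_zero_iff]
  obtain ⟨l, hl⟩ := hx _ hv'
  have hnorm (n : ℕ) : ‖cocycle (φ⁻¹ : Equiv.Perm X) (fun y => reflectedInv (A (φ⁻¹ y))) n x *ᵥ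
      axisReflection *ᵥ v‖ = ‖cocycle (φ⁻¹ : Equiv.Perm X) (fun y => (A (φ⁻¹ y))⁻¹) n x *ᵥ v‖ := by
    have hsemi := semiconjBy_cocycle (φ := (φ⁻¹ : Equiv.Perm X))
      (fun y => semiconjBy_axisReflection_inv (hA (φ⁻¹ y)).det_eq_one) n x
    rw [mulVec_mulVec, ← hsemi.eq, ← mulVec_mulVec, norm_axisReflection_mulVec]
  exact ⟨l, by simpa only [HasExpGrowth, hnorm] using hl⟩

end Rates

end PositiveCocycles

lemma ae_forall_zpow {X : Type*} [MeasurableSpace X] {μ : Measure X} {φ : Equiv.Perm X}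
    (hφ : MeasurePreserving φ μ μ) (hφ_inv : Measurable (φ⁻¹ : Equiv.Perm X)) {p : X → Prop}
    (hp : ∀ᵐ x ∂μ, p x) : ∀ᵐ x ∂μ, ∀ n : ℤ, p ((φ ^ n : Equiv.Perm X) x) := by
  have hφ' : MeasurePreserving (φ⁻¹ : Equiv.Perm X) μ μ :=
    MeasurePreserving.symm ⟨φ, hφ.measurable, hφ_inv⟩ hφ
  refine ae_all_iff.2 fun n => ?_
  obtain ⟨m, rfl | rfl⟩ := n.eq_nat_or_neg
  · simpa only [Equiv.Perm.iterate_eq_pow, zpow_natCast] using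
      (hφ.iterate m).quasiMeasurePreserving.ae hp
  · simpa only [Equiv.Perm.iterate_eq_pow, inv_pow, zpow_neg, zpow_natCast] using
      (hφ'.iterate m).quasiMeasurePreserving.ae hp

section TorusMaps

open Matrix (toEuclideanCLM)
open scoped Matrix

variable {L : ℝ}

/-- In the exponential charts centred at `z` and `φ z`, the map `φ` is given by the matrix `M`
near the origin. -/
def IsLocallyLinearAt (φ : Torus L → Torus L) (z : Torus L) (M : Matrix (Fin 2) (Fin 2) ℝ) :
    Prop :=
  ∀ᶠ h in 𝓝 (0 : Tangent), φ (torusExp z h) = torusExp (φ z) (toEuclideanCLM (𝕜 := ℝ) M h)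

lemma tendsto_toEuclideanCLM_zero (M : Matrix (Fin 2) (Fin 2) ℝ) :
    Tendsto (toEuclideanCLM (𝕜 := ℝ) M) (𝓝 0) (𝓝 0) := by
  simpa only [map_zero] using (toEuclideanCLM (𝕜 := ℝ) M).continuous.tendsto 0

lemma isLocallyLinearAt_id (z : Torus L) : IsLocallyLinearAt id z 1 :=
  .of_forall fun _ => by simp

namespace IsLocallyLinearAt

variable {z : Torus L} {M : Matrix (Fin 2) (Fin 2) ℝ}

lemma comp {φ ψ : Torus L → Torus L} {M' : Matrix (Fin 2) (Fin 2) ℝ}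
    (hψ : IsLocallyLinearAt ψ (φ z) M') (hφ : IsLocallyLinearAt φ z M) :
    IsLocallyLinearAt (ψ ∘ φ) z (M' * M) := by
  filter_upwards [hφ, (tendsto_toEuclideanCLM_zero M).eventually hψ] with h hφh hψh
  rw [Function.comp_apply, hφh, hψh, map_mul]
  rfl

lemma inv {φ : Equiv.Perm (Torus L)} (hφ : IsLocallyLinearAt φ (φ⁻¹ z) M) (hM : M.det = 1) :
    IsLocallyLinearAt (φ⁻¹ : Equiv.Perm (Torus L)) z M⁻¹ := by
  filter_upwards [(tendsto_toEuclideanCLM_zero M⁻¹).eventually hφ] with h hφh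
  have hMM : toEuclideanCLM (𝕜 := ℝ) M (toEuclideanCLM (𝕜 := ℝ) M⁻¹ h) = h := by
    rw [← mul_apply_eq_comp, ← map_mul, Matrix.mul_nonsing_inv _ (hM ▸ isUnit_one), map_one,
      one_apply_eq_self]
  have hcancel : φ (φ⁻¹ z) = z := φ.apply_symm_apply z
  rw [hMM, hcancel] at hφh
  rw [← hφh]
  exact φ.symm_apply_apply _

lemma iterate {φ : Torus L → Torus L} {A : Torus L → Matrix (Fin 2) (Fin 2) ℝ}
    (h : ∀ n, IsLocallyLinearAt φ (φ^[n] z) (A (φ^[n] z))) (n : ℕ) :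
    IsLocallyLinearAt φ^[n] z (cocycle φ A n z) := by
  induction n with
  | zero => exact isLocallyLinearAt_id z
  | succ n ih =>
    rw [Function.iterate_succ']
    exact (h n).comp ih

end IsLocallyLinearAt

variable [Fact (0 < L)]

lemma torusLog_coe {h : Tangent} (hh : ‖h‖ < L / 2) :
    torusLog ((h 0 : AddCircle L), (h 1 : AddCircle L)) = h := by
  have hmem (i : Fin 2) : h i ∈ Set.Ico (-(L / 2)) (-(L / 2) + L) := by
    obtain ⟨hlo, hhi⟩ := abs_lt.1 ((PiLp.norm_apply_le h i).trans_lt hh)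
    exact ⟨hlo.le, by linarith⟩
  ext i
  fin_cases i
  · simpa [torusLog] using AddCircle.equivIco_coe_of_mem (hmem 0)
  · simpa [torusLog] using AddCircle.equivIco_coe_of_mem (hmem 1)

lemma IsLocallyLinearAt.hasFDerivAt {φ : Torus L → Torus L} {z : Torus L}
    {M : Matrix (Fin 2) (Fin 2) ℝ} (h : IsLocallyLinearAt φ z M) :
    HasFDerivAt (torusLocal φ z) (toEuclideanCLM (𝕜 := ℝ) M) 0 := by
  have hL : 0 < L / 2 := half_pos Fact.out
  refine (toEuclideanCLM (𝕜 := ℝ) M).hasFDerivAt.congr_of_eventuallyEq ?_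
  filter_upwards [h, (tendsto_toEuclideanCLM_zero M).eventually (Metric.ball_mem_nhds 0 hL)]
    with v hv hv_small
  rw [torusLocal, hv]
  refine Eq.trans (congrArg torusLog ?_) (torusLog_coe (mem_ball_zero_iff.1 hv_small))
  simp [torusExp, Prod.ext_iff]

variable {φ : Equiv.Perm (Torus L)} {z : Torus L} {v : Tangent}

lemma isLyapunovExponent_atTop_of_hasExpGrowth {C : ℕ → Matrix (Fin 2) (Fin 2) ℝ}
    (hC : ∀ n, IsLocallyLinearAt φ^[n] z (C n)) {l : ℝ}
    (hl : HasExpGrowth (fun n => C n *ᵥ v.ofLp) l) : IsLyapunovExponent φ atTop z v l := by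
  let toTangent := (EuclideanSpace.equiv (Fin 2) ℝ).symm
  have hgrowth : HasExpGrowth (fun n => toEuclideanCLM (𝕜 := ℝ) (C n) v) l :=
    hl.congr_isTheta ⟨toTangent.isBigO_comp_rev _ _, toTangent.isBigO_comp _ _⟩
  rw [IsLyapunovExponent, ← Nat.map_cast_int_atTop, tendsto_map'_iff]
  refine hgrowth.congr fun n => ?_
  rw [Function.comp_apply, zpow_natCast, ← Equiv.Perm.iterate_eq_pow, torusDeriv,
    (hC n).hasFDerivAt.fderiv, Int.cast_natCast]

lemma isLyapunovExponent_atBot_of_inv {χ : ℝ}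
    (hχ : IsLyapunovExponent (φ⁻¹ : Equiv.Perm (Torus L)) atTop z v χ) :
    IsLyapunovExponent φ atBot z v (-χ) := by
  rw [IsLyapunovExponent, ← map_neg_atTop, tendsto_map'_iff]
  refine hχ.neg.congr fun n => ?_
  rw [Function.comp_apply, inv_zpow', Int.cast_neg, one_div_neg_eq_neg_one_div, neg_mul]

theorem ae_exists_isLyapunovExponent {μ : Measure (Torus L)} [IsFiniteMeasure μ]
    (hφ : MeasurePreserving φ μ μ) (hφ_inv : Measurable (φ⁻¹ : Equiv.Perm (Torus L)))
    {A : Torus L → Matrix (Fin 2) (Fin 2) ℝ} (hA : ∀ z, IsPositiveUnimodular (A z))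
    (hAm : ∀ i j, Measurable fun z => A z i j) (hAi : ∀ i j, Integrable (fun z => A z i j) μ)
    (hlin : ∀ᵐ z ∂μ, IsLocallyLinearAt φ z (A z)) :
    ∀ᵐ z ∂μ, (∀ n : ℤ, TorusDifferentiableAt (φ ^ n : Equiv.Perm (Torus L)) z) ∧
      ∀ v : Tangent, v ≠ 0 →
        (∃ χ, IsLyapunovExponent φ atTop z v χ) ∧ ∃ χ, IsLyapunovExponent φ atBot z v χ := by
  filter_upwards [ae_forall_zpow hφ hφ_inv hlin,
    ae_forall_exists_hasExpGrowth hφ hφ_inv hA hAm hAi,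
    ae_forall_exists_hasExpGrowth_inv hφ hφ_inv hA hAm hAi] with z hz hgrowth hgrowth_inv
  have hforward (n : ℕ) : IsLocallyLinearAt φ^[n] z (cocycle φ A n z) :=
    IsLocallyLinearAt.iterate (fun m => by simpa [Equiv.Perm.iterate_eq_pow] using hz m) n
  have hbackward (n : ℕ) : IsLocallyLinearAt (φ⁻¹ : Equiv.Perm (Torus L))^[n] z
      (cocycle (φ⁻¹ : Equiv.Perm (Torus L)) (fun w => (A (φ⁻¹ w))⁻¹) n z) :=
    IsLocallyLinearAt.iterate (fun m => by
      refine IsLocallyLinearAt.inv ?_ (hA _).det_eq_one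
      rw [← Function.iterate_succ_apply' (φ⁻¹ : Equiv.Perm (Torus L)), Equiv.Perm.iterate_eq_pow,
        inv_pow, ← zpow_natCast, ← zpow_neg]
      exact hz _) n
  refine ⟨fun n => ?_, fun v hv => ?_⟩
  · obtain ⟨m, rfl | rfl⟩ := n.eq_nat_or_neg
    · rw [zpow_natCast, ← Equiv.Perm.iterate_eq_pow]
      exact (hforward m).hasFDerivAt.differentiableAt
    · rw [zpow_neg, zpow_natCast, ← inv_pow, ← Equiv.Perm.iterate_eq_pow]
      exact (hbackward m).hasFDerivAt.differentiableAt
  · have hv' : v.ofLp ≠ 0 := by simpa using hv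
    obtain ⟨l, hl⟩ := hgrowth _ hv'
    obtain ⟨l', hl'⟩ := hgrowth_inv _ hv'
    exact ⟨⟨l, isLyapunovExponent_atTop_of_hasExpGrowth hforward hl⟩,
      ⟨-l', isLyapunovExponent_atBot_of_inv
        (isLyapunovExponent_atTop_of_hasExpGrowth hbackward hl')⟩⟩

end TorusMaps

lemma volume_addCircle_singleton {L : ℝ} [Fact (0 < L)] (y : AddCircle L) :
    volume ({y} : Set (AddCircle L)) = 0 := by
  simpa [(Fact.out : 0 < L).le] using AddCircle.volume_closedBall L (x := y) 0

namespace TwistData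

variable {L : ℝ} (T : TwistData L)

lemma lo_lt_hi (i : Fin 2) : T.lo i < T.hi i := by
  fin_cases i
  exacts [T.lo_zero_lt_hi_zero, T.lo_one_lt_hi_one]

lemma finite_endpoints : T.endpoints.Finite := by
  refine ((Set.finite_range fun i => (T.lo i : AddCircle L)).union
    (Set.finite_range fun i => (T.hi i : AddCircle L))).subset ?_
  rintro y ⟨i, rfl | rfl⟩
  exacts [.inl ⟨i, rfl⟩, .inr ⟨i, rfl⟩]

lemma measurableSet_arcs : MeasurableSet T.arcs :=
  .iUnion fun _ => (isCompact_Icc.image (AddCircle.continuous_mk' L)).isClosed.measurableSet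

variable [Fact (0 < L)]

/-- The derivative of the twist supported on the `i`-th arc, off the endpoints of that arc. -/
noncomputable def slopeOn (i : Fin 2) (y : AddCircle L) : ℝ :=
  if (AddCircle.equivIco L (T.lo i) y : ℝ) ≤ T.hi i then
    T.wrap i * L / (T.hi i - T.lo i) else 0

/-- The derivative of the twist function off the endpoints of the arcs. -/
noncomputable def slope (y : AddCircle L) : ℝ := ∑ i, T.slopeOn i y

/-- An upper bound for the derivative of the twist function. -/
noncomputable def slopeBound : ℝ := ∑ i, T.wrap i * L / (T.hi i - T.lo i)

lemma arcSlope_nonneg (i : Fin 2) : 0 ≤ T.wrap i * L / (T.hi i - T.lo i) :=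
  div_nonneg (mul_nonneg (Nat.cast_nonneg _) (Fact.out : 0 < L).le) (sub_pos.2 (T.lo_lt_hi i)).le

lemma slope_nonneg (y : AddCircle L) : 0 ≤ T.slope y :=
  Finset.sum_nonneg fun i _ => by
    rw [slopeOn]
    split_ifs
    exacts [T.arcSlope_nonneg i, le_rfl]

lemma norm_slope_le (y : AddCircle L) : ‖T.slope y‖ ≤ T.slopeBound := by
  rw [Real.norm_of_nonneg (T.slope_nonneg y)]
  refine Finset.sum_le_sum fun i _ => ?_
  rw [slopeOn]
  split_ifs
  exacts [le_rfl, T.arcSlope_nonneg i]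

lemma measurable_coe_equivIco (a : ℝ) :
    Measurable fun y : AddCircle L => (AddCircle.equivIco L a y : ℝ) :=
  measurable_subtype_coe.comp (AddCircle.measurableEquivIco L a).measurable

lemma measurable_slope : Measurable T.slope :=
  Finset.measurable_fun_sum _ fun _ _ => Measurable.ite
    (measurableSet_le (measurable_coe_equivIco _) measurable_const)
    measurable_const measurable_const

lemma measurable_twist : Measurable T.twist :=
  Finset.measurable_fun_sum _ fun _ _ => Measurable.ite
    (measurableSet_le (measurable_coe_equivIco _) measurable_const)
    (AddCircle.measurable_mk'.comp
      ((((measurable_coe_equivIco _).sub_const _).div_const _).const_mul _)) measurable_const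

lemma volume_endpoints : volume T.endpoints = 0 := by
  rw [← Set.biUnion_of_singleton T.endpoints,
    measure_biUnion_null_iff T.finite_endpoints.countable]
  exact fun y _ => volume_addCircle_singleton y

lemma twist_eq_zero {y : AddCircle L} (hy : y ∉ T.arcs) : T.twist y = 0 :=
  Finset.sum_eq_zero fun i _ => by
    refine if_neg fun h => hy (Set.mem_iUnion.2 ⟨i, _, ⟨?_, h⟩, AddCircle.coe_equivIco⟩)
    exact (AddCircle.equivIco L (T.lo i) y).2.1

lemma eventually_twistOn_add {y : AddCircle L} (hy : y ∉ T.endpoints) (i : Fin 2) :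
    ∀ᶠ h : ℝ in 𝓝 0,
      T.twistOn i (y + (h : AddCircle L)) = T.twistOn i y + ((T.slopeOn i y * h : ℝ) : AddCircle L)
    := by
  set t : ℝ := (AddCircle.equivIco L (T.lo i) y : ℝ) with ht_def
  have hty : (t : AddCircle L) = y := AddCircle.coe_equivIco
  have ht : t ∈ Set.Ico (T.lo i) (T.lo i + L) := (AddCircle.equivIco L (T.lo i) y).2
  have hlo : T.lo i < t := lt_of_le_of_ne ht.1 fun h => hy ⟨i, .inl (by rw [← hty, ← h])⟩
  have hhi : t ≠ T.hi i := fun h => hy ⟨i, .inr (by rw [← hty, ← h])⟩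
  have htend : Tendsto (fun h : ℝ => t + h) (𝓝 0) (𝓝 t) := by
    simpa using (continuous_const_add t).tendsto (0 : ℝ)
  have hrep : ∀ᶠ h : ℝ in 𝓝 0,
      (AddCircle.equivIco L (T.lo i) (y + (h : AddCircle L)) : ℝ) = t + h := by
    filter_upwards [htend.eventually (Ioo_mem_nhds hlo ht.2)] with h hh
    rw [← hty, ← AddCircle.coe_add]
    exact AddCircle.equivIco_coe_of_mem ⟨hh.1.le, hh.2⟩
  have hlength := sub_pos.2 (T.lo_lt_hi i)
  rcases lt_or_gt_of_ne hhi with hinside | houtside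
  · filter_upwards [hrep, htend.eventually (Iio_mem_nhds hinside)] with h hh hlt_hi
    simp only [twistOn, slopeOn, hh]
    rw [if_pos (le_of_lt hlt_hi), ← ht_def, if_pos hinside.le, if_pos hinside.le,
      ← AddCircle.coe_add]
    congr 1
    field_simp
    ring
  · filter_upwards [hrep, htend.eventually (Ioi_mem_nhds houtside)] with h hh hgt_hi
    simp only [twistOn, slopeOn, hh]
    rw [if_neg (not_le.2 hgt_hi), ← ht_def, if_neg (not_le.2 houtside),
      if_neg (not_le.2 houtside)]
    simp

lemma eventually_twist_add {y : AddCircle L} (hy : y ∉ T.endpoints) :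
    ∀ᶠ h : ℝ in 𝓝 0,
      T.twist (y + (h : AddCircle L)) = T.twist y + ((T.slope y * h : ℝ) : AddCircle L) := by
  filter_upwards [eventually_all.2 (T.eventually_twistOn_add hy)] with h hh
  simp only [twist, slope, Fin.sum_univ_two, hh, add_mul, AddCircle.coe_add]
  abel

lemma measurePreserving_prodMk_add_twist :
    MeasurePreserving (fun z : Torus L => (z.1, z.2 + T.twist z.1)) volume volume :=
  (MeasurePreserving.id volume).skew_product (g := fun x y => y + T.twist x)
    (measurable_snd.add (T.measurable_twist.comp measurable_fst))
    (.of_forall fun x => map_add_right_eq_self volume (T.twist x))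

end TwistData

namespace LinkedTwist

open Matrix (transvection)

variable {L : ℝ} (Λ : LinkedTwist L)

lemma measurableSet_R : MeasurableSet Λ.R :=
  (measurable_snd Λ.p.measurableSet_arcs).union (measurable_fst Λ.q.measurableSet_arcs)

variable [Fact (0 < L)]

lemma F_mem_R_iff (z : Torus L) : Λ.F z ∈ Λ.R ↔ z ∈ Λ.R := by
  by_cases hz : z.2 ∈ Λ.p.arcs
  · exact iff_of_true (.inl hz) (.inl hz)
  · have hfix : Λ.F z = z := by simp [F, Λ.p.twist_eq_zero hz]
    rw [hfix]

lemma G_mem_R_iff (z : Torus L) : Λ.G z ∈ Λ.R ↔ z ∈ Λ.R := by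
  by_cases hz : z.1 ∈ Λ.q.arcs
  · exact iff_of_true (.inr hz) (.inr hz)
  · have hfix : Λ.G z = z := by simp [G, Λ.q.twist_eq_zero hz]
    rw [hfix]

lemma H_mem_R_iff (z : Torus L) : Λ.H z ∈ Λ.R ↔ z ∈ Λ.R :=
  (Λ.G_mem_R_iff _).trans (Λ.F_mem_R_iff z)

lemma zpow_H_mem_R (n : ℤ) {z : Torus L} (hz : z ∈ Λ.R) :
    (Λ.H ^ n : Equiv.Perm (Torus L)) z ∈ Λ.R := by
  induction n with
  | zero => exact hz
  | succ n ih =>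
    rw [add_comm, zpow_add, zpow_one, Equiv.Perm.mul_apply]
    exact (Λ.H_mem_R_iff _).2 ih
  | pred n ih =>
    rw [sub_eq_add_neg, add_comm, zpow_add, zpow_neg_one, Equiv.Perm.mul_apply]
    rw [← Λ.H_mem_R_iff]
    simpa using ih

lemma isLocallyLinearAt_F {z : Torus L} (hz : z ∉ Λ.bdP) :
    IsLocallyLinearAt Λ.F z (transvection 0 1 (Λ.p.slope z.2)) := by
  have hcoord : Tendsto (fun h : Tangent => h 1) (𝓝 0) (𝓝 0) :=
    (by fun_prop : Continuous fun h : Tangent => h 1).tendsto' 0 0 rfl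
  filter_upwards [hcoord.eventually (Λ.p.eventually_twist_add hz)] with h hh
  refine Prod.ext ?_ ?_ <;>
    simp [F, torusExp, hh, transvection_mulVec, add_assoc, add_left_comm]

lemma isLocallyLinearAt_G {z : Torus L} (hz : z ∉ Λ.bdQ) :
    IsLocallyLinearAt Λ.G z (transvection 1 0 (Λ.q.slope z.1)) := by
  have hcoord : Tendsto (fun h : Tangent => h 0) (𝓝 0) (𝓝 0) :=
    (by fun_prop : Continuous fun h : Tangent => h 0).tendsto' 0 0 rfl
  filter_upwards [hcoord.eventually (Λ.q.eventually_twist_add hz)] with h hh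
  refine Prod.ext ?_ ?_ <;>
    simp [G, torusExp, hh, transvection_mulVec, add_assoc, add_left_comm]

/-- The matrix of the derivative of `H` at `z`, for `z` off the set `s₀`. -/
noncomputable def derivH (z : Torus L) : Matrix (Fin 2) (Fin 2) ℝ :=
  transvection 1 0 (Λ.q.slope (Λ.F z).1) * transvection 0 1 (Λ.p.slope z.2)

lemma isLocallyLinearAt_H {z : Torus L} (hz : z ∉ Λ.s₀) :
    IsLocallyLinearAt Λ.H z (Λ.derivH z) :=
  (Λ.isLocallyLinearAt_G fun h => hz (.inr h)).comp (Λ.isLocallyLinearAt_F fun h => hz (.inl h))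

lemma isPositiveUnimodular_derivH (z : Torus L) : IsPositiveUnimodular (Λ.derivH z) :=
  isPositiveUnimodular_transvection_mul_transvection (Λ.p.slope_nonneg _) (Λ.q.slope_nonneg _)

lemma measurable_F : Measurable Λ.F :=
  (measurable_fst.add (Λ.p.measurable_twist.comp measurable_snd)).prodMk measurable_snd

lemma measurable_slope_F_fst : Measurable fun z : Torus L => Λ.q.slope (Λ.F z).1 :=
  Λ.q.measurable_slope.comp (measurable_fst.comp Λ.measurable_F)

lemma measurable_derivH_apply (i j : Fin 2) : Measurable fun z => Λ.derivH z i j := by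
  have hp := Λ.p.measurable_slope.comp (measurable_snd : Measurable fun z : Torus L => z.2)
  have hq := Λ.measurable_slope_F_fst
  simp only [derivH, transvection_mul_transvection_eq]
  fin_cases i <;> fin_cases j
  exacts [measurable_const, hp, hq, (hq.mul hp).const_add 1]

lemma integrable_derivH_apply (i j : Fin 2) : Integrable fun z => Λ.derivH z i j := by
  have hp : Integrable fun z : Torus L => Λ.p.slope z.2 :=
    .of_bound (Λ.p.measurable_slope.comp measurable_snd).aestronglyMeasurable _
      (.of_forall fun z => Λ.p.norm_slope_le z.2)
  have hq_bound (z : Torus L) := Λ.q.norm_slope_le (Λ.F z).1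
  have hq_meas := Λ.measurable_slope_F_fst.aestronglyMeasurable (μ := volume)
  simp only [derivH, transvection_mul_transvection_eq]
  fin_cases i <;> fin_cases j
  exacts [integrable_const 1, hp, .of_bound hq_meas _ (.of_forall hq_bound),
    (integrable_const 1).add (hp.bdd_mul hq_meas (.of_forall hq_bound))]

lemma measurable_H_inv : Measurable (Λ.H⁻¹ : Equiv.Perm (Torus L)) := by
  have hF : Measurable (Λ.F⁻¹ : Equiv.Perm (Torus L)) :=
    (measurable_fst.sub (Λ.p.measurable_twist.comp measurable_snd)).prodMk measurable_snd
  have hG : Measurable (Λ.G⁻¹ : Equiv.Perm (Torus L)) :=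
    measurable_fst.prodMk (measurable_snd.sub (Λ.q.measurable_twist.comp measurable_fst))
  rw [H, mul_inv_rev]
  exact hF.comp hG

lemma measurePreserving_F : MeasurePreserving Λ.F volume volume := by
  have hswap : MeasurePreserving (Prod.swap : Torus L → Torus L) volume volume :=
    Measure.measurePreserving_swap
  exact hswap.comp (Λ.p.measurePreserving_prodMk_add_twist.comp hswap)

lemma measurePreserving_H : MeasurePreserving Λ.H volume volume :=
  Λ.q.measurePreserving_prodMk_add_twist.comp Λ.measurePreserving_F

lemma volume_s₀ : volume Λ.s₀ = 0 :=
  measure_union_null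
    (Measure.quasiMeasurePreserving_snd.preimage_null Λ.p.volume_endpoints)
    (Λ.measurePreserving_F.quasiMeasurePreserving.preimage_null
      (Measure.quasiMeasurePreserving_fst.preimage_null Λ.q.volume_endpoints))

lemma mem_J_of_forall_zpow_notMem_s₀ {z : Torus L} (hR : z ∈ Λ.R)
    (hz : ∀ n : ℤ, (Λ.H ^ n : Equiv.Perm (Torus L)) z ∉ Λ.s₀) : z ∈ Λ.J := by
  refine Set.mem_iInter.2 fun i => ⟨(Λ.H ^ (-i) : Equiv.Perm (Torus L)) z,
    ⟨⟨Λ.zpow_H_mem_R _ hR, hz _⟩, fun h => hz (1 + -i) ?_⟩, ?_⟩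
  · rw [zpow_add, zpow_one]
    exact h
  · rw [← Equiv.Perm.mul_apply, ← zpow_add, add_neg_cancel, zpow_zero, Equiv.Perm.one_apply]

end LinkedTwist

theorem mainTheorem4 (L : ℝ) [Fact (0 < L)] (Λ : LinkedTwist L) :
    ∀ᵐ z ∂Λ.μ,
      z ∈ Λ.J ∧
      (∀ n : ℤ, TorusDifferentiableAt (Λ.H ^ n : Equiv.Perm (Torus L)) z) ∧
      ∀ v : Tangent, v ≠ 0 →
        (∃ χ : ℝ, IsLyapunovExponent Λ.H Filter.atTop z v χ) ∧
        (∃ χ : ℝ, IsLyapunovExponent Λ.H Filter.atBot z v χ) := by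
  have hs₀ : ∀ᵐ z : Torus L, z ∉ Λ.s₀ := measure_eq_zero_iff_ae_notMem.1 Λ.volume_s₀
  have hac : Λ.μ ≪ volume := ProbabilityTheory.cond_absolutelyContinuous
  filter_upwards [ProbabilityTheory.ae_cond_mem Λ.measurableSet_R,
    hac.ae_le (ae_forall_zpow Λ.measurePreserving_H Λ.measurable_H_inv hs₀),
    hac.ae_le (ae_exists_isLyapunovExponent Λ.measurePreserving_H Λ.measurable_H_inv
      Λ.isPositiveUnimodular_derivH Λ.measurable_derivH_apply Λ.integrable_derivH_apply
      (hs₀.mono fun _ => Λ.isLocallyLinearAt_H))] with z hR hz hexponents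
  exact ⟨Λ.mem_J_of_forall_zpow_notMem_s₀ hR hz, hexponents⟩
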